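/- Let $P$ be a self-adjoint operator with compact resolvent on a complex Hilbert space $H$, whose eigenvalues are $\lambda_n=A(n)$ with multiplicities $M_n=B(n)$, $n\in\mathbb N=\{0,1,2,\dots\}$ (if $B(n)=0$, this means that $A(n)$ is not an eigenvalue), where $$A(n)=a(n+\alpha)^{2k}+\beta,\qquad B(n)=\sum_{j=0}^{q} b_j\,(n+\alpha)^{2j},\qquad b_q\neq 0,$$ with $a>0$, $\alpha\in\tfrac12\mathbb N$, $\beta\in\mathbb R$, $k\ge 1$, $q\ge 0$ integers and $b_0,\dots,b_q\in\mathbb R$. Put $L=\frac{1+2q}{2k}$, and let $\tilde\alpha=\alpha-\lfloor\alpha\rfloor$. (1) For every $t>0$ the operator $e^{-tP}$ is trace class, and $h(t):=\operatorname{Tr}e^{-tP}=\sum_{n\ge0}B(n)e^{-tA(n)}$. (2) (Generalized Jacobi identity.) There is a function $F_\infty:(0,\infty)\to\mathbb R$, smooth on $(0,\infty)$, such that $F_\infty$ and all its derivatives are $o(t^R)$ as $t\downarrow0$ for every $R\in\mathbb R$, such that $F_\infty$ is not identically zero on any interval $(0,T)$, $T>0$, and such that for all $t>0$ (with $0^0=1$)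 $$h(t)=e^{-t\beta}\Big[\sum_{j=0}^{q}\frac{b_j}{2k}\,\Gamma\!\Big(\frac{1+2j}{2k}\Big)(at)^{-\frac{1+2j}{2k}}-b_0\Big(\tilde\alpha-\frac12\Big)-\sum_{j=0}^{q}b_j\sum_{n=0}^{\lfloor\alpha\rfloor-1}(n+\tilde\alpha)^{2j}e^{-ta(n+\tilde\alpha)^{2k}}\Big]+F_\infty(t).$$ (3) (Almost exact, not exact.) Let $N\in\mathbb N$ be such that $A(n)>0$ for all $n\ge N$. The truncated zeta function $\zeta^N(s)=\sum_{n\ge N}B(n)A(n)^{-s}$, $\operatorname{Re}s>L$, has a meromorphic continuation to $\mathbb C$; all poles of $\Gamma(s)\zeta^N(s)$ are at most simple and lie among the points $s_m=L-\frac{m}{2k}$, $m\in\mathbb N$. Let $c_m=\operatorname{Res}_{s=s_m}\Gamma(s)\zeta^N(s)$, which is real, and let $h^N(t)=h(t)-\sum_{n<N}B(n)e^{-tA(n)}$. Then $h^N(t)\sim\sum_{m\ge0}c_m t^{-s_m}$ as $t\downarrow0$, i.e. $h^N(t)-\sum_{m<K}c_mt^{-s_m}=O(t^{-s_K})$ for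 every $K\in\mathbb N$. The series $\sum_m c_mt^{-s_m}$ converges locally uniformly on $(0,\infty)$ to $h^N(t)-F_\infty(t)$, with the same $F_\infty$ as in (2): the expansion is almost exact for all $t>0$. It is not exact: on no interval $(0,T)$, $T>0$, does the series converge locally uniformly to $h^N$. (4) If $\beta=0$ and $N+\alpha\le 1$, then only finitely many $c_m$ are non-zero, so that the expansion has finitely many terms. -/

import Mathlib

open Filter Topology Set
open scoped ContDiff InnerProductSpace

noncomputable section

namespace HeatTrace

/-! ### Unbounded operators with discrete spectrum -/

section Operators

variable {H : Type*} [NormedAddCommGroup H] [InnerProductSpace ℂ H]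

/-- The eigenspace of a partially defined operator `P`: all `v` in the domain with `P v = μ v`. -/
def eigenspace (P : H →ₗ.[ℂ] H) (μ : ℂ) : Submodule ℂ H :=
  (LinearMap.ker (P.toFun - μ • P.domain.subtype)).map P.domain.subtype

/-- `P` has compact resolvent: for some real `μ` the operator `P - μ` is a bijection from the domain
of `P` onto `H` whose inverse `R` is a compact operator on `H`. -/
def HasCompactResolvent (P : H →ₗ.[ℂ] H) : Prop :=
  ∃ (μ : ℝ) (R : H →L[ℂ] H), IsCompactOperator R ∧
    (∀ x : H, ∃ hx : R x ∈ P.domain, P ⟨R x, hx⟩ - (μ : ℂ) • R x = x) ∧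
    (∀ y : P.domain, R (P y - (μ : ℂ) • (y : H)) = y)

/-- `P` is a self-adjoint operator with compact resolvent whose eigenvalues are the numbers
`lam n` and in which `lam n` has (finite) multiplicity `M n`. (If `M n = 0` for some `n`, this
says that `lam n` is not an eigenvalue.) -/
structure HasSpectrum [CompleteSpace H] (P : H →ₗ.[ℂ] H) (lam M : ℕ → ℝ) : Prop where
  selfAdjoint : IsSelfAdjoint P
  compactResolvent : HasCompactResolvent P
  eigenvalue_mem : ∀ μ : ℂ, eigenspace P μ ≠ ⊥ → ∃ n, μ = (lam n : ℂ)
  finiteDimensional : ∀ n, FiniteDimensional ℂ (eigenspace P (lam n : ℂ))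
  multiplicity : ∀ n, (Module.finrank ℂ (eigenspace P (lam n : ℂ)) : ℝ) = M n

/-- The bounded operator `T` is `exp (-t P)`: it acts as `exp (-t μ)` on each eigenspace of `P`.
For self-adjoint `P` with compact resolvent the eigenvectors span a dense subspace, so that this
determines `T`. -/
def IsExpNeg (P : H →ₗ.[ℂ] H) (t : ℝ) (T : H →L[ℂ] H) : Prop :=
  ∀ μ : ℝ, ∀ v ∈ eigenspace P (μ : ℂ), T v = (Real.exp (-t * μ) : ℂ) • v

open Classical in
/-- The operator `exp (-t P)` (and `0` if there is no such bounded operator). -/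
def expNeg (P : H →ₗ.[ℂ] H) (t : ℝ) : H →L[ℂ] H :=
  if h : ∃ T, IsExpNeg P t T then h.choose else 0

end Operators

section Trace

universe u

variable {H : Type u} [NormedAddCommGroup H] [InnerProductSpace ℂ H] [CompleteSpace H]

/-- `T` is trace class: `∑ ⟨e_i, |T| e_i⟩ < ∞` for every orthonormal basis, `|T| = √(T* T)`. -/
def IsTraceClass (T : H →L[ℂ] H) : Prop :=
  ∀ (ι : Type u) (e : HilbertBasis ι ℂ H), Summable fun i => ⟪e i, CFC.abs T (e i)⟫_ℂ

/-- The trace `∑ ⟨e_i, T e_i⟩`, for some orthonormal basis; if `T` is trace class, the value does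
not depend on the basis. -/
def trace (T : H →L[ℂ] H) : ℂ :=
  ∑' i, ⟪(exists_hilbertBasis ℂ H).choose_spec.choose i,
    T ((exists_hilbertBasis ℂ H).choose_spec.choose i)⟫_ℂ

/-- The heat trace `t ↦ Tr exp (-t P)`. -/
def heatTrace (P : H →ₗ.[ℂ] H) (t : ℝ) : ℝ := (trace (expNeg P t)).re

end Trace

/-! ### Zeta functions and residues -/

/-- `Z` is a meromorphic continuation to the whole plane of the truncated zeta function
`∑_{n ≥ N} M n * (lam n) ^ (-s)`, whose series converges for `re s > L`. -/
def IsZetaContinuation (lam M : ℕ → ℝ) (N : ℕ) (L : ℝ) (Z : ℂ → ℂ) : Prop :=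
  Meromorphic Z ∧ ∀ s : ℂ, L < s.re →
    HasSum (fun n : ℕ => (M (n + N) : ℂ) * (lam (n + N) : ℂ) ^ (-s)) (Z s)

/-- `c` is the residue of `f` at the isolated singularity `z₀`, i.e. the normalized integral of `f`
over all sufficiently small circles around `z₀`. -/
def HasResidueAt (f : ℂ → ℂ) (z₀ c : ℂ) : Prop :=
  ∀ᶠ r : ℝ in 𝓝[>] 0, (2 * (Real.pi : ℂ) * Complex.I)⁻¹ * (∮ z in C(z₀, r), f z) = c

/-! ### Expansions at `0` -/

/-- `f t ~ ∑ c m * t ^ e m` as `t ↓ 0`: every remainder is of the order of the next power. -/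
def IsAsymptoticExpansion (f : ℝ → ℝ) (c e : ℕ → ℝ) : Prop :=
  ∀ K : ℕ, (fun t : ℝ => f t - ∑ m ∈ Finset.range K, c m * t ^ e m) =O[𝓝[>] 0]
    fun t : ℝ => t ^ e K

/-- The series `∑ c m * t ^ e m` converges, locally uniformly on `S`, to `f - F`: an almost exact
expansion of `f` on `S`, with remainder `F`. -/
def IsAlmostExactOn (f : ℝ → ℝ) (c e : ℕ → ℝ) (F : ℝ → ℝ) (S : Set ℝ) : Prop :=
  TendstoLocallyUniformlyOn (fun (K : ℕ) (t : ℝ) => ∑ m ∈ Finset.range K, c m * t ^ e m)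
    (fun t => f t - F t) atTop S

/-- The expansion is exact on `S`: it is almost exact with remainder zero. -/
def IsExactOn (f : ℝ → ℝ) (c e : ℕ → ℝ) (S : Set ℝ) : Prop :=
  IsAlmostExactOn f c e (fun _ => 0) S

/-- `F` is smooth on `(0, ∞)` and it is flat at `0`: the function and all its derivatives decay
faster than every power of `t` as `t ↓ 0` (so its Taylor expansion at `0` is null). -/
def IsFlat (F : ℝ → ℝ) : Prop :=
  ContDiffOn ℝ ∞ F (Ioi 0) ∧
    ∀ (j : ℕ) (R : ℝ), iteratedDeriv j F =o[𝓝[>] 0] fun t : ℝ => t ^ R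

/-! ### The spectral data -/

/-- The eigenvalues `A n = a (n + α) ^ (2 k) + β`. -/
def polyA (a α β : ℝ) (k n : ℕ) : ℝ := a * ((n : ℝ) + α) ^ (2 * k) + β

/-- The multiplicities `B n = ∑_{j ≤ q} b_j (n + α) ^ (2 j)`, of degree `2 q` if `b_q ≠ 0`. -/
def polyB (b : ℕ → ℝ) (q : ℕ) (α : ℝ) (n : ℕ) : ℝ :=
  ∑ j ∈ Finset.range (q + 1), b j * ((n : ℝ) + α) ^ (2 * j)

/-- The abscissa of convergence `(1 + deg B) / deg A`. -/
def polyL (k q : ℕ) : ℝ := (1 + 2 * (q : ℝ)) / (2 * (k : ℝ))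

/-- The candidate poles `(1 + deg B) / deg A - m / deg A`. -/
def polePt (k q m : ℕ) : ℝ := polyL k q - (m : ℝ) / (2 * (k : ℝ))

/-- The truncated heat trace `Tr exp (-t P) - ∑_{n < N} M n * exp (-t lam n)`. -/
def truncHeatTrace {H : Type*} [NormedAddCommGroup H] [InnerProductSpace ℂ H] [CompleteSpace H]
    (P : H →ₗ.[ℂ] H) (lam M : ℕ → ℝ) (N : ℕ) (t : ℝ) : ℝ :=
  heatTrace P t - ∑ n ∈ Finset.range N, M n * Real.exp (-t * lam n)

/-- The explicit finite part of the generalized Jacobi identity, where `Int.fract α` is the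
fractional part of `α` and `⌊α⌋₊` its integer part. -/
def jacobiMain (a α β : ℝ) (k : ℕ) (b : ℕ → ℝ) (q : ℕ) (t : ℝ) : ℝ :=
  Real.exp (-t * β) *
    ((∑ j ∈ Finset.range (q + 1), b j * (1 / (2 * (k : ℝ))) *
        Real.Gamma ((1 + 2 * (j : ℝ)) / (2 * (k : ℝ))) *
          (a * t) ^ (-((1 + 2 * (j : ℝ)) / (2 * (k : ℝ)))))
      - b 0 * (Int.fract α - 1 / 2)
      - ∑ j ∈ Finset.range (q + 1), b j * ∑ n ∈ Finset.range ⌊α⌋₊,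
          ((n : ℝ) + Int.fract α) ^ (2 * j) *
            Real.exp (-t * (a * ((n : ℝ) + Int.fract α) ^ (2 * k))))

end HeatTrace

end

open Filter Topology Set
open scoped ContDiff InnerProductSpace

noncomputable section

namespace HeatTrace

/-! ### Eigenvectors of a self-adjoint operator with compact resolvent -/

section SpectralTheory

variable {H : Type*} [NormedAddCommGroup H] [InnerProductSpace ℂ H]

/-! Spectral side. By the spectral theorem for the compact resolvent, `P` has a Hilbert basis of
eigenvectors. In it `e^{-tP}` is a positive diagonal operator, and its trace is the eigenvalue
series (`HasSpectrum.heatTrace_spec`).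

Jacobi identity. Since `2α` is an integer, the fractional part `x` of `α` is `0` or `1/2`, so the
lattice `x + ℤ` is symmetric about `0`. A sum of the even function `y^(2j) exp(-t a y^(2k))` over `x
+ ℕ` is thus half of a sum over `x + ℤ`, up to the term at `0`. In the Poisson formula the zero
frequency gives the Gamma term, and the other frequencies together are smaller than every power of
`t` (`exists_norm_tsum_sub_integral_le`, `exists_abs_jacobiRem_le`). Differentiation in `t` sends
the remainder of index `j` to a multiple of the one of index `j + k`, so all derivatives are flat as
well. The remainder is real analytic: if it vanished on some `(0, T)` it would vanish on `(0, ∞)`,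
and letting `t → ∞` would make a nonzero polynomial in `t^(-1/(2k))` exponentially small
(`not_forall_sum_jacobiRem_eq_zero`).

Zeta function. The explicit part, minus the first `N` terms, is `t^(-L)` times an everywhere
convergent power series in `t^(1/(2k))`; its coefficients are the `c_m`
(`exists_hasSum_jacobiMain`). Split the Mellin integral of `h^N` at `1`. The series integrates
termwise over `(0, 1]` to `∑ c_m / (s - s_m)`; what remains is entire, because `F` is flat at `0`
and `h^N` decays exponentially (`exists_mellin_continuation`). The Mellin transform is `Γ ζ^N`, so
the `c_m` are its residues. Their series sums to `h^N - F`, and it cannot also sum to `h^N` on `(0,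
T)` because `F` does not vanish there. -/

lemma mem_eigenspace {P : H →ₗ.[ℂ] H} {μ : ℂ} {v : H} :
    v ∈ eigenspace P μ ↔ ∃ h : v ∈ P.domain, P ⟨v, h⟩ = μ • v := by
  unfold eigenspace
  rw [Submodule.mem_map]
  constructor
  · rintro ⟨⟨w, hw⟩, h, rfl⟩
    refine ⟨hw, ?_⟩
    simpa [sub_eq_zero] using h
  · rintro ⟨h, hv⟩
    exact ⟨⟨v, h⟩, by simpa [sub_eq_zero] using hv, rfl⟩

lemma inner_eq_zero_of_mem_eigenspace {P : H →ₗ.[ℂ] H}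
    (hs : ∀ x y : P.domain, ⟪P x, (y : H)⟫_ℂ = ⟪(x : H), P y⟫_ℂ) {μ ν : ℝ} (hμν : μ ≠ ν)
    {v w : H} (hv : v ∈ eigenspace P (μ : ℂ)) (hw : w ∈ eigenspace P (ν : ℂ)) :
    ⟪v, w⟫_ℂ = 0 := by
  obtain ⟨hv', hv⟩ := mem_eigenspace.1 hv
  obtain ⟨hw', hw⟩ := mem_eigenspace.1 hw
  have h := hs ⟨v, hv'⟩ ⟨w, hw'⟩
  simp only [hv, hw, inner_smul_left, inner_smul_right, Complex.conj_ofReal] at h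
  have h2 : ((μ : ℂ) - ν) * ⟪v, w⟫_ℂ = 0 := by linear_combination h
  rcases mul_eq_zero.1 h2 with h3 | h3
  · exact absurd (by exact_mod_cast sub_eq_zero.1 h3) hμν
  · exact h3

variable [CompleteSpace H]

lemma inner_map_eq_of_isSelfAdjoint {P : H →ₗ.[ℂ] H} (hP : IsSelfAdjoint P) (x y : P.domain) :
    ⟪P x, (y : H)⟫_ℂ = ⟪(x : H), P y⟫_ℂ := by
  have h := LinearPMap.adjoint_isFormalAdjoint (T := P) hP.dense_domain
  rw [LinearPMap.isSelfAdjoint_def.1 hP] at h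
  exact h x y

variable {P : H →ₗ.[ℂ] H} {lam M : ℕ → ℝ}

/-- The eigenvectors of a self-adjoint operator with compact resolvent are complete. -/
lemma HasSpectrum.orthogonal_iSup_eigenspace (hP : HasSpectrum P lam M) :
    (⨆ n, eigenspace P (lam n : ℂ))ᗮ = ⊥ := by
  have hs := inner_map_eq_of_isSelfAdjoint hP.selfAdjoint
  obtain ⟨μ, R, hc, h1, h2⟩ := hP.compactResolvent
  -- Symmetry passes from `P` to `R` by writing `x = (P - μ) R x` and `y = (P - μ) R y`; the shift
  -- cancels since `μ` is real.
  have hR : (R : H →ₗ[ℂ] H).IsSymmetric := by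
    intro x y
    obtain ⟨hx, hx'⟩ := h1 x
    obtain ⟨hy, hy'⟩ := h1 y
    have h := hs ⟨R x, hx⟩ ⟨R y, hy⟩
    change ⟪R x, y⟫_ℂ = ⟪x, R y⟫_ℂ
    conv_lhs => rw [← hy']
    conv_rhs => rw [← hx']
    rw [inner_sub_left, inner_sub_right, h, inner_smul_left, inner_smul_right, Complex.conj_ofReal]
  have h := ContinuousLinearMap.orthogonalComplement_iSup_eigenspaces_eq_bot hc hR
  rw [eq_bot_iff, ← h]
  apply Submodule.orthogonal_le
  refine iSup_le fun ν v hv => ?_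
  have hv' : R v = ν • v := Module.End.mem_eigenspace_iff.1 hv
  obtain ⟨hx, hx'⟩ := h1 v
  by_cases hv0 : v = 0
  · rw [hv0]; exact Submodule.zero_mem _
  have hν : ν ≠ 0 := by
    rintro rfl
    rw [zero_smul] at hv'
    apply hv0
    rw [← hx']
    have : (⟨R v, hx⟩ : P.domain) = 0 := Subtype.ext hv'
    rw [this, LinearPMap.map_zero, hv', smul_zero, sub_zero]
  -- Dividing `(P - μ) R v = v` by `ν`, with `R v = ν v`, gives `P v = (μ + ν⁻¹) v`.
  have hmem : v ∈ eigenspace P (μ + ν⁻¹) := by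
    have hd : v = ν⁻¹ • R v := by rw [hv', smul_smul, inv_mul_cancel₀ hν, one_smul]
    have hvd : v ∈ P.domain := by rw [hd]; exact P.domain.smul_mem _ hx
    refine mem_eigenspace.2 ⟨hvd, ?_⟩
    have e : (⟨v, hvd⟩ : P.domain) = ν⁻¹ • ⟨R v, hx⟩ := Subtype.ext hd
    rw [e, LinearPMap.map_smul, sub_eq_iff_eq_add.1 hx', hv', smul_add, add_smul, smul_smul,
      smul_smul, add_comm]
    congr 2
    field_simp
  obtain ⟨n, hn⟩ := hP.eigenvalue_mem _
    (fun hb => hv0 (by rw [hb] at hmem; exact (Submodule.mem_bot ℂ).1 hmem))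
  rw [hn] at hmem
  exact Submodule.mem_iSup_of_mem n hmem

lemma HasSpectrum.orthogonalFamily (hP : HasSpectrum P lam M) (hl : Function.Injective lam) :
    OrthogonalFamily ℂ (fun n => eigenspace P (lam n : ℂ))
      (fun n => (eigenspace P (lam n : ℂ)).subtypeₗᵢ) := fun _ _ hmn v w =>
  inner_eq_zero_of_mem_eigenspace (inner_map_eq_of_isSelfAdjoint hP.selfAdjoint) (hl.ne hmn)
    v.2 w.2

/-- A Hilbert basis of eigenvectors. -/
lemma HasSpectrum.exists_hilbertBasis (hP : HasSpectrum P lam M) (hl : Function.Injective lam) :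
    ∃ e : HilbertBasis (Σ n, Fin (Module.finrank ℂ (eigenspace P (lam n : ℂ)))) ℂ H,
      ∀ i, e i ∈ eigenspace P (lam i.1 : ℂ) := by
  have := hP.finiteDimensional
  let v : ∀ n, OrthonormalBasis (Fin (Module.finrank ℂ (eigenspace P (lam n : ℂ)))) ℂ
      (eigenspace P (lam n : ℂ)) := fun n => stdOrthonormalBasis ℂ _
  have ho := (hP.orthogonalFamily hl).orthonormal_sigma_orthonormal
    (v_family := fun n i => v n i) (fun n => (v n).orthonormal)
  refine ⟨HilbertBasis.mkOfOrthogonalEqBot ho ?_, fun i => ?_⟩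
  · rw [eq_bot_iff, ← hP.orthogonal_iSup_eigenspace]
    apply Submodule.orthogonal_le
    refine iSup_le fun n => ?_
    have hsp : Submodule.map (eigenspace P (lam n : ℂ)).subtype
        (Submodule.span ℂ (Set.range (v n))) = eigenspace P (lam n : ℂ) := by
      have := (v n).toBasis.span_eq
      rw [OrthonormalBasis.coe_toBasis] at this
      rw [this, Submodule.map_top, Submodule.range_subtype]
    conv_lhs => rw [← hsp]
    rw [Submodule.map_span]
    apply Submodule.span_mono
    rintro _ ⟨_, ⟨i, rfl⟩, rfl⟩
    exact ⟨⟨n, i⟩, rfl⟩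
  · rw [HilbertBasis.coe_mkOfOrthogonalEqBot]
    exact (v i.1 i.2).2

end SpectralTheory

/-! ### Diagonal operators with summable coefficients and their traces -/

section Diagonal

variable {H : Type*} [NormedAddCommGroup H] [InnerProductSpace ℂ H] [CompleteSpace H]
  {ι : Type*}

/-- The diagonal operator `∑ w i ⟨e i, ·⟩ e i` with absolutely summable coefficients. -/
def diagonalOp (e : HilbertBasis ι ℂ H) (w : ι → ℝ) : H →L[ℂ] H :=
  ∑' i, (w i : ℂ) • InnerProductSpace.rankOne ℂ (e i) (e i)

variable {e : HilbertBasis ι ℂ H} {w : ι → ℝ}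

lemma hasSum_diagonalOp_apply (hw : Summable fun i => |w i|) (x : H) :
    HasSum (fun i => (w i : ℂ) • ⟪e i, x⟫_ℂ • e i) (diagonalOp e w x) := by
  have h : Summable fun i => (w i : ℂ) • InnerProductSpace.rankOne ℂ (e i) (e i) := by
    refine Summable.of_norm ?_
    refine hw.congr fun i => ?_
    rw [norm_smul, InnerProductSpace.norm_rankOne, e.orthonormal.norm_eq_one]
    simp
  simpa [diagonalOp] using (ContinuousLinearMap.apply ℂ H x).hasSum h.hasSum

/-- The alternative is what an eigenvector `x` offers: each `e i` either has the same eigenvalue or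
is orthogonal to `x`. -/
lemma diagonalOp_apply_eq_smul (hw : Summable fun i => |w i|) {x : H} {c : ℝ}
    (h : ∀ i, w i = c ∨ ⟪e i, x⟫_ℂ = 0) : diagonalOp e w x = (c : ℂ) • x := by
  refine (hasSum_diagonalOp_apply hw x).unique ?_
  convert (e.hasSum_repr x).const_smul (c : ℂ) using 2 with i
  rw [e.repr_apply_apply]
  rcases h i with h | h <;> simp [h]

lemma hasSum_inner_diagonalOp (hw : Summable fun i => |w i|) (x y : H) :
    HasSum (fun i => (w i : ℂ) * (⟪e i, x⟫_ℂ * ⟪y, e i⟫_ℂ)) ⟪y, diagonalOp e w x⟫_ℂ := by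
  have h := (innerSL ℂ y).hasSum (hasSum_diagonalOp_apply (e := e) hw x)
  simpa only [innerSL_apply_apply, inner_smul_right] using h

lemma diagonalOp_isPositive (hw : Summable fun i => |w i|) (h0 : ∀ i, 0 ≤ w i) :
    (diagonalOp e w).IsPositive := by
  rw [ContinuousLinearMap.isPositive_iff]
  refine ⟨fun x y => ?_, fun x => ?_⟩
  · change ⟪diagonalOp e w x, y⟫_ℂ = ⟪x, diagonalOp e w y⟫_ℂ
    refine HasSum.unique ?_ (hasSum_inner_diagonalOp hw y x)
    have := (hasSum_inner_diagonalOp (e := e) hw x y).map (starRingEnd ℂ) Complex.continuous_conj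
    rw [inner_conj_symm] at this
    convert this using 2 with i
    simp only [Function.comp, map_mul, Complex.conj_ofReal, inner_conj_symm]
    ring
  · rw [← inner_conj_symm]
    have h := hasSum_inner_diagonalOp (e := e) hw x x
    have h2 : HasSum (fun i => ((w i * ‖⟪e i, x⟫_ℂ‖ ^ 2 : ℝ) : ℂ)) ⟪x, diagonalOp e w x⟫_ℂ := by
      convert h using 2 with i
      rw [← inner_conj_symm x (e i), Complex.mul_conj, Complex.normSq_eq_norm_sq]
      push_cast; ring
    obtain ⟨r, hr⟩ := h2.summable.map Complex.reCLM Complex.reCLM.continuous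
    have hr' : HasSum (fun i => w i * ‖⟪e i, x⟫_ℂ‖ ^ 2) r := by
      simpa [Function.comp_def, ← Complex.ofReal_pow] using hr
    have h3 : ⟪x, diagonalOp e w x⟫_ℂ = (r : ℂ) :=
      h2.unique (Complex.hasSum_ofReal.2 hr')
    have : 0 ≤ r := hr'.nonneg fun i => mul_nonneg (h0 i) (by positivity)
    rw [h3, Complex.conj_ofReal]
    exact_mod_cast this

/-- Basis independence of the trace: the double series of `w i * ‖⟪e i, f j⟫‖ ^ 2` has non-negative
terms, so it may be summed in either order. Summing over `j` first gives `w i` by Parseval. -/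
lemma hasSum_inner_diagonalOp_self (hw : Summable w) (h0 : ∀ i, 0 ≤ w i) {κ : Type*}
    (f : HilbertBasis κ ℂ H) :
    HasSum (fun j => ⟪f j, diagonalOp e w (f j)⟫_ℂ) ((∑' i, w i : ℝ) : ℂ) := by
  have hw' : Summable fun i => |w i| := by simpa only [abs_of_nonneg (h0 _)] using hw
  have hpar : ∀ i, HasSum (fun j => w i * ‖⟪e i, f j⟫_ℂ‖ ^ 2) (w i) := fun i => by
    have h := f.hasSum_inner_mul_inner (e i) (e i)
    rw [inner_self_eq_norm_sq_to_K, e.orthonormal.norm_eq_one] at h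
    have h2 : HasSum (fun j => ‖⟪e i, f j⟫_ℂ‖ ^ 2) 1 := by
      rw [← Complex.hasSum_ofReal]
      have he : ∀ j, ((‖⟪e i, f j⟫_ℂ‖ ^ 2 : ℝ) : ℂ) = ⟪e i, f j⟫_ℂ * ⟪f j, e i⟫_ℂ := fun j => by
        rw [← inner_conj_symm (f j), Complex.mul_conj, Complex.normSq_eq_norm_sq]
      simpa only [he, RCLike.ofReal_one, Complex.ofReal_one, one_pow] using h
    simpa using h2.mul_left (w i)
  have hsum : Summable fun p : ι × κ => w p.1 * ‖⟪e p.1, f p.2⟫_ℂ‖ ^ 2 := by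
    rw [summable_prod_of_nonneg fun p => mul_nonneg (h0 _) (by positivity)]
    exact ⟨fun i => (hpar i).summable, by simpa only [(hpar _).tsum_eq] using hw⟩
  have hcol : ∀ j, HasSum (fun i => w i * ‖⟪e i, f j⟫_ℂ‖ ^ 2) (∑' i, w i * ‖⟪e i, f j⟫_ℂ‖ ^ 2) :=
    fun j => (hsum.prod_symm.prod_factor j).hasSum
  have hval : ∀ j, ⟪f j, diagonalOp e w (f j)⟫_ℂ = ((∑' i, w i * ‖⟪e i, f j⟫_ℂ‖ ^ 2 : ℝ) : ℂ) :=
    fun j => by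
      refine (hasSum_inner_diagonalOp hw' _ _).unique ?_
      convert Complex.hasSum_ofReal.2 (hcol j) using 2 with i
      rw [← inner_conj_symm (f j), Complex.mul_conj, Complex.normSq_eq_norm_sq]
      push_cast; ring
  simp_rw [hval]
  rw [Complex.hasSum_ofReal]
  have h1 := hsum.prod_symm.hasSum.prod_fiberwise hcol
  have h2 := hsum.hasSum.prod_fiberwise hpar
  have h3 : ∑' p : κ × ι, w p.swap.1 * ‖⟪e p.swap.1, f p.swap.2⟫_ℂ‖ ^ 2
      = ∑' p : ι × κ, w p.1 * ‖⟪e p.1, f p.2⟫_ℂ‖ ^ 2 :=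
    (Equiv.prodComm κ ι).tsum_eq fun p : ι × κ => w p.1 * ‖⟪e p.1, f p.2⟫_ℂ‖ ^ 2
  rw [h2.tsum_eq, ← h3]
  exact h1

end Diagonal

/-! ### The heat operator and its trace -/

section HeatOperator

universe u

variable {H : Type u} [NormedAddCommGroup H] [InnerProductSpace ℂ H] [CompleteSpace H]
  {P : H →ₗ.[ℂ] H} {lam M : ℕ → ℝ}

lemma HasSpectrum.isExpNeg_unique (hP : HasSpectrum P lam M) {t : ℝ} {T T' : H →L[ℂ] H}
    (hT : IsExpNeg P t T) (hT' : IsExpNeg P t T') : T = T' := by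
  have hd : Dense ((⨆ n, eigenspace P (lam n : ℂ) : Submodule ℂ H) : Set H) := by
    rw [Submodule.dense_iff_topologicalClosure_eq_top,
      Submodule.topologicalClosure_eq_top_iff]
    exact hP.orthogonal_iSup_eigenspace
  have hle : (⨆ n, eigenspace P (lam n : ℂ)) ≤ LinearMap.eqLocus (T : H →ₗ[ℂ] H) T' :=
    iSup_le fun n v hv => by
      change T v = T' v
      rw [hT _ v hv, hT' _ v hv]
  refine ContinuousLinearMap.coeFn_injective (T.continuous.ext_on hd T'.continuous fun v hv => ?_)
  exact hle hv

/-- Injectivity of `lam` ensures that no eigenspace is counted twice. The diagonal operator is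
positive, hence equal to its absolute value, so one trace computation settles both trace class and
value. -/
theorem HasSpectrum.heatTrace_spec (hP : HasSpectrum P lam M) (hl : Function.Injective lam)
    {t : ℝ} (hsum : Summable fun n => M n * Real.exp (-t * lam n)) :
    (∃! T : H →L[ℂ] H, IsExpNeg P t T) ∧ IsTraceClass (expNeg P t) ∧
      HasSum (fun n => M n * Real.exp (-t * lam n)) (heatTrace P t) := by
  obtain ⟨e, he⟩ := hP.exists_hilbertBasis hl
  set w : (Σ n, Fin (Module.finrank ℂ (eigenspace P (lam n : ℂ)))) → ℝ :=
    fun i => Real.exp (-t * lam i.1) with hwdef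
  have h0 : ∀ i, 0 ≤ w i := fun i => (Real.exp_pos _).le
  have hfib : ∀ n, HasSum (fun i => w ⟨n, i⟩) (M n * Real.exp (-t * lam n)) := fun n => by
    have := hasSum_fintype (fun i => w ⟨n, i⟩)
    simpa [hwdef, hP.multiplicity n] using this
  have hw : Summable w := by
    rw [summable_sigma_of_nonneg h0]
    exact ⟨fun n => (hfib n).summable, by simpa only [(hfib _).tsum_eq] using hsum⟩
  have hw' : Summable fun i => |w i| := by simpa only [abs_of_nonneg (h0 _)] using hw
  have hT : IsExpNeg P t (diagonalOp e w) := by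
    intro μ v hv
    apply diagonalOp_apply_eq_smul hw'
    intro i
    by_cases hμ : lam i.1 = μ
    · left; rw [hwdef, ← hμ]
    · right
      exact inner_eq_zero_of_mem_eigenspace (inner_map_eq_of_isSelfAdjoint hP.selfAdjoint) hμ
        (he i) hv
  have hex : ∃ T, IsExpNeg P t T := ⟨_, hT⟩
  have heq : expNeg P t = diagonalOp e w := by
    rw [expNeg, dif_pos hex]
    exact hP.isExpNeg_unique hex.choose_spec hT
  refine ⟨⟨_, hT, fun T' hT' => hP.isExpNeg_unique hT' hT⟩, fun κ f => ?_, ?_⟩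
  · have hp : 0 ≤ diagonalOp e w :=
      (ContinuousLinearMap.nonneg_iff_isPositive _).2 (diagonalOp_isPositive hw' h0)
    rw [heq, CFC.abs_of_nonneg _ hp]
    exact (hasSum_inner_diagonalOp_self hw h0 f).summable
  · have : heatTrace P t = ∑' i, w i := by
      rw [heatTrace, trace, heq, (hasSum_inner_diagonalOp_self hw h0 _).tsum_eq, Complex.ofReal_re]
    rw [this]
    exact hw.hasSum.sigma hfib

end HeatOperator

/-! ### Elementary bounds for powers times exponentials -/

section Decay

lemma exists_pow_mul_exp_neg_le (m : ℕ) {k : ℕ} (hk : 0 < k) {ε : ℝ} (hε : 0 < ε) :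
    ∃ C, 0 ≤ C ∧ ∀ y : ℝ, |y| ^ m * Real.exp (-ε * y ^ (2 * k)) ≤ C := by
  refine ⟨1 + m.factorial / ε ^ m, by positivity, fun y => ?_⟩
  have hy : y ^ (2 * k) = |y| ^ (2 * k) := by rw [pow_mul, pow_mul, sq_abs]
  rw [hy]
  set z := |y| with hz
  have hz0 : 0 ≤ z := abs_nonneg y
  have h1 : z ^ m ≤ 1 + (z ^ (2 * k)) ^ m := by
    rcases le_total z 1 with h | h
    · have := pow_le_one₀ (n := m) hz0 h
      have : 0 ≤ (z ^ (2 * k)) ^ m := by positivity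
      linarith
    · have h2 : z ≤ z ^ (2 * k) := le_self_pow₀ h (by omega)
      have := pow_le_pow_left₀ hz0 h2 m
      linarith
  have h2 : (z ^ (2 * k)) ^ m * Real.exp (-ε * z ^ (2 * k)) ≤ m.factorial / ε ^ m := by
    have h := Real.pow_div_factorial_le_exp (ε * z ^ (2 * k)) (by positivity) m
    rw [neg_mul, Real.exp_neg, ← div_eq_mul_inv, div_le_iff₀ (Real.exp_pos _)]
    rw [mul_pow] at h
    have hf : (0 : ℝ) < m.factorial := by positivity
    rw [div_le_iff₀ hf] at h
    rw [div_mul_eq_mul_div, le_div_iff₀ (by positivity)]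
    nlinarith
  have h3 : Real.exp (-ε * z ^ (2 * k)) ≤ 1 := by
    rw [Real.exp_le_one_iff, neg_mul]
    have : 0 ≤ ε * z ^ (2 * k) := by positivity
    linarith
  calc z ^ m * Real.exp (-ε * z ^ (2 * k))
      ≤ (1 + (z ^ (2 * k)) ^ m) * Real.exp (-ε * z ^ (2 * k)) := by gcongr
    _ ≤ _ := by rw [add_mul, one_mul]; exact add_le_add h3 h2

lemma summable_pow_mul_exp_neg {x : ℝ} (hx : 0 ≤ x) (m : ℕ) {k : ℕ} (hk : 0 < k) {ε : ℝ}
    (hε : 0 < ε) :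
    Summable fun n : ℕ => ((n : ℝ) + x) ^ m * Real.exp (-ε * ((n : ℝ) + x) ^ (2 * k)) := by
  obtain ⟨C, -, hC⟩ := exists_pow_mul_exp_neg_le (m + 2) hk hε
  refine Summable.of_norm_bounded_eventually_nat
    (g := fun n : ℕ => C * (1 / (n : ℝ) ^ 2)) ?_ ?_
  · exact (Real.summable_one_div_nat_pow.2 one_lt_two).mul_left C
  · filter_upwards [eventually_ge_atTop 1] with n hn
    have hn' : (0 : ℝ) < n := by exact_mod_cast hn
    have h := hC ((n : ℝ) + x)
    rw [abs_of_nonneg (by positivity)] at h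
    rw [Real.norm_of_nonneg (by positivity), mul_one_div, le_div_iff₀ (by positivity)]
    refine le_trans ?_ h
    rw [pow_add, mul_right_comm]
    gcongr
    linarith

end Decay

/-! ### Exponential series: analyticity, derivative, decay at infinity -/

section ExpSum

/-- The exponential series `∑ w n exp (-z lam n)`. -/
def expSum (w lam : ℕ → ℝ) (z : ℂ) : ℂ := ∑' n, (w n : ℂ) * Complex.exp (-z * lam n)

/-- The exponential series `∑ w n exp (-t lam n)` at a real argument. -/
def realExpSum (w lam : ℕ → ℝ) (t : ℝ) : ℝ := ∑' n, w n * Real.exp (-t * lam n)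

/-- The exponents are non-negative and the series converges absolutely for all `t > 0`. -/
structure IsHeatSeries (w lam : ℕ → ℝ) : Prop where
  nonneg : ∀ n, 0 ≤ lam n
  summable : ∀ ε : ℝ, 0 < ε → Summable fun n => |w n| * Real.exp (-ε * lam n)

variable {w lam : ℕ → ℝ}

lemma ofReal_realExpSum (w lam : ℕ → ℝ) (t : ℝ) :
    (realExpSum w lam t : ℂ) = expSum w lam (t : ℂ) := by
  rw [realExpSum, expSum, Complex.ofReal_tsum]
  push_cast
  rfl

namespace IsHeatSeries

lemma hasSum (h : IsHeatSeries w lam) {t : ℝ} (ht : 0 < t) :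
    HasSum (fun n => w n * Real.exp (-t * lam n)) (realExpSum w lam t) := by
  refine Summable.hasSum (Summable.of_norm ?_)
  simpa using h.summable t ht

lemma norm_term_le (h : IsHeatSeries w lam) {ε : ℝ} (n : ℕ) {z : ℂ} (hz : ε < z.re) :
    ‖(w n : ℂ) * Complex.exp (-z * lam n)‖ ≤ |w n| * Real.exp (-ε * lam n) := by
  rw [norm_mul, Complex.norm_exp, Complex.norm_real, Real.norm_eq_abs]
  simp only [Complex.mul_re, Complex.neg_re, Complex.ofReal_re, Complex.ofReal_im, mul_zero,
    sub_zero]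
  have := h.nonneg n
  gcongr

lemma differentiable_term (w lam : ℕ → ℝ) (n : ℕ) :
    Differentiable ℂ fun z : ℂ => (w n : ℂ) * Complex.exp (-z * lam n) := by fun_prop

/-- The argument is complex because locally uniform limits of holomorphic functions are holomorphic;
termwise derivatives and real analyticity on `(0, ∞)` then follow. -/
lemma differentiableAt (h : IsHeatSeries w lam) {z : ℂ} (hz : 0 < z.re) :
    DifferentiableAt ℂ (expSum w lam) z := by
  have hU : IsOpen {s : ℂ | z.re / 2 < s.re} := isOpen_lt continuous_const Complex.continuous_re
  exact (Complex.differentiableOn_tsum_of_summable_norm (h.summable (z.re / 2) (by positivity))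
    (fun n => (differentiable_term w lam n).differentiableOn) hU
    (fun n s hs => h.norm_term_le n hs)).differentiableAt
      (hU.mem_nhds (by simp only [mem_ofPred_eq]; linarith))

lemma hasDerivAt (h : IsHeatSeries w lam) {z : ℂ} (hz : 0 < z.re) :
    HasDerivAt (expSum w lam) (-expSum (fun n => w n * lam n) lam z) z := by
  have hU : IsOpen {s : ℂ | z.re / 2 < s.re} := isOpen_lt continuous_const Complex.continuous_re
  have hd := Complex.hasSum_deriv_of_summable_norm (h.summable (z.re / 2) (by positivity))
    (fun n => (differentiable_term w lam n).differentiableOn) hU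
    (fun n s hs => h.norm_term_le n hs) (z := z) (by simp only [mem_ofPred_eq]; linarith)
  have he : ∀ n, deriv (fun z : ℂ => (w n : ℂ) * Complex.exp (-z * lam n)) z
      = -(((w n * lam n : ℝ) : ℂ) * Complex.exp (-z * lam n)) := fun n => by
    have := (((hasDerivAt_id z).neg.mul_const (lam n : ℂ)).cexp).const_mul (w n : ℂ)
    refine (HasDerivAt.deriv this).trans ?_
    push_cast
    simp only [Pi.neg_apply, id]
    ring
  simp_rw [he] at hd
  have he : -expSum (fun n => w n * lam n) lam z = deriv (expSum w lam) z := by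
    have := hd.tsum_eq
    rw [tsum_neg] at this
    exact this
  rw [he]
  exact (h.differentiableAt hz).hasDerivAt

lemma hasDerivAt_real (h : IsHeatSeries w lam) {t : ℝ} (ht : 0 < t) :
    HasDerivAt (realExpSum w lam) (-realExpSum (fun n => w n * lam n) lam t) t := by
  have := (h.hasDerivAt (z := (t : ℂ)) (by simpa using ht)).real_of_complex
  simpa only [← ofReal_realExpSum, ← Complex.ofReal_neg, Complex.ofReal_re] using this

lemma continuousOn_real (h : IsHeatSeries w lam) : ContinuousOn (realExpSum w lam) (Ioi 0) :=
  fun _ ht => (h.hasDerivAt_real ht).continuousAt.continuousWithinAt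

lemma analyticAt_real (h : IsHeatSeries w lam) {t : ℝ} (ht : 0 < t) :
    AnalyticAt ℝ (realExpSum w lam) t := by
  have hU : IsOpen {s : ℂ | 0 < s.re} := isOpen_lt continuous_const Complex.continuous_re
  have h1 : AnalyticAt ℂ (expSum w lam) (t : ℂ) :=
    DifferentiableOn.analyticAt (s := {s : ℂ | 0 < s.re})
      (fun s hs => (h.differentiableAt hs).differentiableWithinAt) (hU.mem_nhds (by simpa using ht))
  have h2 := (Complex.reCLM.analyticAt _).comp
    ((h1.restrictScalars (𝕜 := ℝ)).comp (Complex.ofRealCLM.analyticAt t))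
  refine h2.congr (Eventually.of_forall fun s => ?_)
  simp [← ofReal_realExpSum]

/-- For `t ≥ 1` and `lam n ≥ δ`, `(t - 1)(lam n - δ) ≥ 0` bounds `exp (-t lam n)` by `exp δ * exp
(-δ t) * exp (-lam n)`, and the series converges at `t = 1`. -/
lemma isBigO_exp (h : IsHeatSeries w lam) {δ : ℝ} (hδ : ∀ n, w n = 0 ∨ δ ≤ lam n) :
    realExpSum w lam =O[atTop] fun t => Real.exp (-δ * t) := by
  refine Asymptotics.IsBigO.of_bound (Real.exp δ * ∑' n, |w n| * Real.exp (-1 * lam n)) ?_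
  filter_upwards [eventually_ge_atTop 1] with t ht
  have hs := h.summable 1 one_pos
  rw [Real.norm_of_nonneg (Real.exp_pos _).le, realExpSum, mul_right_comm, ← Real.exp_add,
    ← tsum_mul_left]
  refine tsum_of_norm_bounded (hs.mul_left _).hasSum fun n => ?_
  rcases hδ n with h0 | h0
  · simp [h0]
  · rw [norm_mul, Real.norm_eq_abs, Real.norm_of_nonneg (Real.exp_pos _).le, mul_left_comm,
      ← Real.exp_add]
    gcongr
    nlinarith

end IsHeatSeries

lemma isHeatSeries_pow {x : ℝ} (hx : 0 ≤ x) {a : ℝ} (ha : 0 < a) (m : ℕ) {k : ℕ} (hk : 0 < k) :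
    IsHeatSeries (fun n => ((n : ℝ) + x) ^ m) (fun n => a * ((n : ℝ) + x) ^ (2 * k)) := by
  refine ⟨fun n => by positivity, fun ε hε => ?_⟩
  refine (summable_pow_mul_exp_neg hx m hk (mul_pos hε ha)).congr fun n => ?_
  rw [abs_of_nonneg (by positivity)]
  congr 2
  ring

end ExpSum

open scoped SchwartzMap FourierTransform

/-! ### The Schwartz functions to which Poisson summation is applied -/

section PolyExpSchwartz

/-- The function `Q x * exp (-x ^ (2 k))`. -/
def polyExp (k : ℕ) (Q : Polynomial ℂ) (x : ℝ) : ℂ :=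
  Q.eval (x : ℂ) * Complex.exp (-(x : ℂ) ^ (2 * k))

/-- Closure of this class under differentiation reduces every Schwartz seminorm to plain decay of
its members. -/
lemma deriv_polyExp (k : ℕ) (Q : Polynomial ℂ) : deriv (polyExp k Q) =
    polyExp k (Q.derivative - (2 * k : ℂ) • (Polynomial.X ^ (2 * k - 1) * Q)) := by
  ext x
  have h := ((Q.hasDerivAt (x : ℂ)).mul
    (((hasDerivAt_pow (2 * k) (x : ℂ)).neg).cexp)).comp_ofReal
  refine (HasDerivAt.deriv h).trans ?_
  simp only [polyExp, Polynomial.eval_sub, Polynomial.eval_smul, Polynomial.eval_mul,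
    Polynomial.eval_pow, Polynomial.eval_X, smul_eq_mul, Pi.neg_apply]
  push_cast
  ring

lemma exists_iteratedDeriv_polyExp (k n : ℕ) (Q : Polynomial ℂ) :
    ∃ Q', iteratedDeriv n (polyExp k Q) = polyExp k Q' := by
  induction n with
  | zero => exact ⟨Q, iteratedDeriv_zero⟩
  | succ n ih =>
    obtain ⟨Q', h⟩ := ih
    rw [iteratedDeriv_succ, h, deriv_polyExp]
    exact ⟨_, rfl⟩

lemma norm_exp_neg_pow (k : ℕ) (x : ℝ) :
    ‖Complex.exp (-(x : ℂ) ^ (2 * k))‖ = Real.exp (-1 * x ^ (2 * k)) := by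
  rw [Complex.norm_exp, ← Complex.ofReal_pow, ← Complex.ofReal_neg, Complex.ofReal_re, neg_one_mul]

lemma exists_norm_polyExp_le {k : ℕ} (hk : 0 < k) (p : ℕ) (Q : Polynomial ℂ) :
    ∃ C, ∀ x : ℝ, ‖x‖ ^ p * ‖polyExp k Q x‖ ≤ C := by
  induction Q using Polynomial.induction_on' with
  | add Q₁ Q₂ h₁ h₂ =>
    obtain ⟨C₁, h₁⟩ := h₁
    obtain ⟨C₂, h₂⟩ := h₂
    refine ⟨C₁ + C₂, fun x => ?_⟩
    have : polyExp k (Q₁ + Q₂) x = polyExp k Q₁ x + polyExp k Q₂ x := by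
      simp only [polyExp, Polynomial.eval_add, add_mul]
    rw [this]
    calc _ ≤ ‖x‖ ^ p * (‖polyExp k Q₁ x‖ + ‖polyExp k Q₂ x‖) := by
            gcongr; exact norm_add_le _ _
      _ ≤ _ := by rw [mul_add]; exact add_le_add (h₁ x) (h₂ x)
  | monomial n c =>
    obtain ⟨C, -, hC⟩ := exists_pow_mul_exp_neg_le (p + n) hk one_pos
    refine ⟨‖c‖ * C, fun x => ?_⟩
    rw [polyExp, Polynomial.eval_monomial, norm_mul, norm_mul, norm_exp_neg_pow, norm_pow,
      Complex.norm_real, Real.norm_eq_abs]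
    calc _ = ‖c‖ * (|x| ^ (p + n) * Real.exp (-1 * x ^ (2 * k))) := by ring
      _ ≤ _ := by gcongr; exact hC x

/-- The Schwartz function `x ^ m * exp (-x ^ (2 k))`. -/
def powExpSchwartz (m : ℕ) {k : ℕ} (hk : 0 < k) : 𝓢(ℝ, ℂ) where
  toFun := polyExp k (Polynomial.X ^ m)
  smooth' := by
    have : polyExp k (Polynomial.X ^ m) =
        fun x : ℝ => (x : ℂ) ^ m * Complex.exp (-(x : ℂ) ^ (2 * k)) := by
      ext x; simp [polyExp]
    rw [this]
    have h : ContDiff ℝ ∞ (fun x : ℝ => (x : ℂ)) := Complex.ofRealCLM.contDiff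
    exact (h.pow m).mul (h.pow (2 * k)).neg.cexp
  decay' p n := by
    obtain ⟨Q, hQ⟩ := exists_iteratedDeriv_polyExp k n (Polynomial.X ^ m)
    obtain ⟨C, hC⟩ := exists_norm_polyExp_le hk p Q
    refine ⟨C, fun x => ?_⟩
    rw [norm_iteratedFDeriv_eq_norm_iteratedDeriv, hQ]
    exact hC x

lemma powExpSchwartz_apply (m : ℕ) {k : ℕ} (hk : 0 < k) (x : ℝ) :
    powExpSchwartz m hk x = ((x ^ m * Real.exp (-x ^ (2 * k)) : ℝ) : ℂ) := by
  change polyExp k (Polynomial.X ^ m) x = _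
  simp [polyExp]

lemma integral_powExpSchwartz (j : ℕ) {k : ℕ} (hk : 0 < k) :
    ∫ x, powExpSchwartz (2 * j) hk x =
      ((2 * (1 / (2 * (k : ℝ)) * Real.Gamma ((1 + 2 * (j : ℝ)) / (2 * (k : ℝ)))) : ℝ) : ℂ) := by
  simp_rw [powExpSchwartz_apply]
  rw [integral_complex_ofReal]
  congr 1
  have h := integral_comp_abs (f := fun x : ℝ => x ^ (2 * j) * Real.exp (-x ^ (2 * k)))
  simp only [pow_mul, sq_abs] at h ⊢
  rw [h]
  congr 1
  have h2 := integral_rpow_mul_exp_neg_rpow (p := 2 * k) (q := 2 * j) (by positivity)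
    (by linarith [Nat.cast_nonneg (α := ℝ) j])
  rw [add_comm (1 : ℝ), ← h2]
  refine MeasureTheory.setIntegral_congr_fun measurableSet_Ioi fun x hx => ?_
  have e : ∀ n : ℕ, (x ^ 2) ^ n = x ^ (2 * (n : ℝ)) := fun n => by
    rw [← pow_mul, ← Real.rpow_natCast, Nat.cast_mul, Nat.cast_ofNat]
  simp only [e]

end PolyExpSchwartz

/-! ### Poisson summation and Riemann sums -/

section Poisson

lemma fourier_comp_mul_left (f : ℝ → ℂ) {τ : ℝ} (hτ : 0 < τ) (w : ℝ) :
    𝓕 (fun y => f (τ * y)) w = (τ⁻¹ : ℂ) * 𝓕 f (w / τ) := by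
  rw [Real.fourier_real_eq_integral_exp_smul, Real.fourier_real_eq_integral_exp_smul]
  have h := MeasureTheory.Measure.integral_comp_mul_left
    (fun y : ℝ => Complex.exp (↑(-2 * Real.pi * y * (w / τ)) * Complex.I) • f y) τ
  rw [abs_of_pos (inv_pos.2 hτ), Complex.real_smul, Complex.ofReal_inv] at h
  rw [← h]
  congr 1
  ext y
  congr 4
  field_simp

/-- Riemann sums of a Schwartz function of mesh `τ` agree with the integral to infinite order. -/
lemma exists_norm_tsum_sub_integral_le (f : 𝓢(ℝ, ℂ)) (R : ℕ) :
    ∃ C, ∀ τ : ℝ, 0 < τ → ∀ x : ℝ,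
      ‖∑' n : ℤ, f (τ * (x + n)) - (τ⁻¹ : ℂ) * ∫ y, f y‖ ≤ C * τ ^ (R + 1) := by
  -- Of the `R + 2` powers, two make the sum over frequencies converge; the prefactor `τ⁻¹` turns `τ
  -- ^ (R + 2)` into `τ ^ (R + 1)`.
  obtain ⟨C, hC0, hC⟩ := (𝓕 f).decay (R + 2) 0
  refine ⟨C * ∑' n : ℤ, 1 / (n : ℝ) ^ 2, fun τ hτ x => ?_⟩
  let g : 𝓢(ℝ, ℂ) := SchwartzMap.compCLMOfContinuousLinearEquiv ℂ
    (ContinuousLinearEquiv.unitsEquivAut ℝ (Units.mk0 τ hτ.ne')) f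
  have hg : ∀ y, g y = f (τ * y) := fun y => by
    simp [g, mul_comm]
  have hg' : (g : ℝ → ℂ) = fun y => f (τ * y) := funext hg
  have hF : ∀ w : ℝ, 𝓕 g w = (τ⁻¹ : ℂ) * 𝓕 f (w / τ) := fun w => by
    rw [SchwartzMap.fourier_coe, SchwartzMap.fourier_coe, hg', fourier_comp_mul_left _ hτ]
  have hP := SchwartzMap.tsum_eq_tsum_fourier g x
  simp only [hg] at hP
  rw [hP]
  set a : ℤ → ℂ := fun n => 𝓕 g n * fourier n (x : UnitAddCircle) with ha
  have ha0 : a 0 = (τ⁻¹ : ℂ) * ∫ y, f y := by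
    simp only [ha, hF, fourier_zero, mul_one, Int.cast_zero, zero_div]
    rw [SchwartzMap.fourier_coe, Real.fourier_real_eq_integral_exp_smul]
    simp
  have hS : Summable fun n : ℤ => C * τ ^ (R + 1) * (1 / (n : ℝ) ^ 2) :=
    (Real.summable_one_div_int_pow.2 one_lt_two).mul_left _
  have hb : ∀ n : ℤ, n ≠ 0 → ‖a n‖ ≤ C * τ ^ (R + 1) * (1 / (n : ℝ) ^ 2) := fun n hn => by
    have h1 := hC ((n : ℝ) / τ)
    rw [norm_iteratedFDeriv_zero, norm_div, Real.norm_of_nonneg hτ.le, Real.norm_eq_abs] at h1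
    have hn1 : (1 : ℝ) ≤ |(n : ℝ)| := by exact_mod_cast Int.one_le_abs hn
    have hfour : ‖fourier n (x : UnitAddCircle)‖ = 1 := by
      rw [fourier_apply]; exact Circle.norm_coe _
    rw [ha]
    simp only [norm_mul, hF, hfour, mul_one, norm_inv, Complex.norm_real,
      Real.norm_of_nonneg hτ.le]
    rw [mul_one_div, le_div_iff₀ (by positivity), ← sq_abs (n : ℝ)]
    have h2 : |(n : ℝ)| ^ 2 ≤ |(n : ℝ)| ^ (R + 2) := pow_le_pow_right₀ hn1 (by omega)
    rw [div_pow, div_mul_eq_mul_div, div_le_iff₀ (by positivity)] at h1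
    calc τ⁻¹ * ‖𝓕 f ((n : ℝ) / τ)‖ * |(n : ℝ)| ^ 2
        ≤ τ⁻¹ * ‖𝓕 f ((n : ℝ) / τ)‖ * |(n : ℝ)| ^ (R + 2) := by gcongr
      _ = τ⁻¹ * (|(n : ℝ)| ^ (R + 2) * ‖𝓕 f ((n : ℝ) / τ)‖) := by ring
      _ ≤ τ⁻¹ * (C * τ ^ (R + 2)) := by gcongr
      _ = C * τ ^ (R + 1) := by rw [pow_succ τ (R + 1)]; field_simp
  have hsum : Summable a := by
    refine Summable.of_norm_bounded_eventually hS ?_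
    rw [Filter.eventually_cofinite]
    refine (Set.finite_singleton (0 : ℤ)).subset fun n hn => ?_
    by_contra h
    exact hn (hb n h)
  rw [hsum.tsum_eq_add_tsum_ite 0, ha0, add_sub_cancel_left]
  rw [mul_right_comm, ← tsum_mul_left]
  refine tsum_of_norm_bounded hS.hasSum fun n => ?_
  -- At `n = 0` the majorant `1 / n ^ 2` is `0` by convention, which suffices since the zero
  -- frequency has been removed.
  split_ifs with h
  · simp [h]
  · exact hb n h

end Poisson

/-! ### The flat remainder of a single power -/

section JacobiRemainder

/-- The `j`-th power series `∑ (n + x) ^ (2 j) exp (-t a (n + x) ^ (2 k))`. -/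
def powHeat (a x : ℝ) (k j : ℕ) (t : ℝ) : ℝ :=
  realExpSum (fun n => ((n : ℝ) + x) ^ (2 * j)) (fun n => a * ((n : ℝ) + x) ^ (2 * k)) t

/-- The remainder in the Jacobi identity of `powHeat`. -/
def jacobiRem (a x : ℝ) (k j : ℕ) (t : ℝ) : ℝ :=
  powHeat a x k j t + (if j = 0 then x - 1 / 2 else 0) -
    1 / (2 * (k : ℝ)) * Real.Gamma ((1 + 2 * (j : ℝ)) / (2 * (k : ℝ))) *
      (a * t) ^ (-((1 + 2 * (j : ℝ)) / (2 * (k : ℝ))))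

variable {a x : ℝ} {k : ℕ}

lemma isHeatSeries_powHeat (ha : 0 < a) (hx : 0 ≤ x) (hk : 0 < k) (j : ℕ) :
    IsHeatSeries (fun n => ((n : ℝ) + x) ^ (2 * j)) (fun n => a * ((n : ℝ) + x) ^ (2 * k)) :=
  isHeatSeries_pow hx ha (2 * j) hk

lemma hasDerivAt_powHeat (ha : 0 < a) (hx : 0 ≤ x) (hk : 0 < k) (j : ℕ) {t : ℝ} (ht : 0 < t) :
    HasDerivAt (powHeat a x k j) (-a * powHeat a x k (j + k) t) t := by
  refine ((isHeatSeries_powHeat ha hx hk j).hasDerivAt_real ht).congr_deriv ?_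
  simp only [powHeat, realExpSum]
  rw [neg_mul, ← tsum_mul_left]
  congr 2
  ext n
  ring

/-- The Gamma terms match because `Γ(s + 1) = s Γ(s)`; the constant disappears, consistently with `j
+ k ≠ 0`. -/
lemma hasDerivAt_jacobiRem (ha : 0 < a) (hx : 0 ≤ x) (hk : 0 < k) (j : ℕ) {t : ℝ} (ht : 0 < t) :
    HasDerivAt (jacobiRem a x k j) (-a * jacobiRem a x k (j + k) t) t := by
  set s : ℝ := (1 + 2 * (j : ℝ)) / (2 * (k : ℝ)) with hs
  have hs0 : 0 < s := by positivity
  have hs1 : (1 + 2 * ((j + k : ℕ) : ℝ)) / (2 * (k : ℝ)) = s + 1 := by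
    rw [hs]; push_cast; field_simp; ring
  have h1 := hasDerivAt_powHeat ha hx hk j ht
  have h2 : HasDerivAt (fun t => (a * t) ^ (-s)) (a * (-s) * (a * t) ^ (-s - 1)) t := by
    have := ((hasDerivAt_id t).const_mul a).rpow_const (p := -s) (Or.inl (mul_pos ha ht).ne')
    simpa using this
  have h3 := (h1.add_const (if j = 0 then x - 1 / 2 else 0)).sub
    (h2.const_mul (1 / (2 * (k : ℝ)) * Real.Gamma s))
  refine h3.congr_deriv ?_
  have hjk : j + k ≠ 0 := by omega
  rw [jacobiRem, if_neg hjk, hs1, Real.Gamma_add_one hs0.ne', show -(s + 1) = -s - 1 by ring]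
  ring

lemma analyticAt_rpow_const {s y : ℝ} (hy : 0 < y) : AnalyticAt ℝ (fun t : ℝ => t ^ s) y := by
  have h : AnalyticAt ℝ (fun t : ℝ => Real.exp (Real.log t * s)) y :=
    ((analyticAt_log hy).mul analyticAt_const).rexp
  refine h.congr ?_
  filter_upwards [lt_mem_nhds hy] with t ht
  rw [Real.rpow_def_of_pos ht]

lemma analyticAt_jacobiRem (ha : 0 < a) (hx : 0 ≤ x) (hk : 0 < k) (j : ℕ) {t : ℝ} (ht : 0 < t) :
    AnalyticAt ℝ (jacobiRem a x k j) t := by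
  have h1 : AnalyticAt ℝ (powHeat a x k j) t := (isHeatSeries_powHeat ha hx hk j).analyticAt_real ht
  have h2 : AnalyticAt ℝ (fun t : ℝ => (a * t) ^ (-((1 + 2 * (j : ℝ)) / (2 * (k : ℝ))))) t :=
    (analyticAt_rpow_const (mul_pos ha ht)).comp (analyticAt_const.mul analyticAt_id)
  exact (h1.add analyticAt_const).sub (analyticAt_const.mul h2)

/-- For `x = 1/2` the reflection `y ↦ -y` exchanges the two halves of `x + ℤ`. For `x = 0` doubling
counts the origin twice, and its term is `1` if `j = 0` and `0` otherwise. -/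
lemma hasSum_int_powHeat (ha : 0 < a) (hx : x = 0 ∨ x = 1 / 2) (hk : 0 < k) (j : ℕ) {t : ℝ}
    (ht : 0 < t) :
    HasSum (fun n : ℤ => (x + n) ^ (2 * j) * Real.exp (-t * (a * (x + n) ^ (2 * k))))
      (2 * (powHeat a x k j t + if j = 0 then x - 1 / 2 else 0)) := by
  have hx0 : 0 ≤ x := by rcases hx with rfl | rfl <;> norm_num
  have h := (isHeatSeries_powHeat ha hx0 hk j).hasSum ht
  change HasSum _ (powHeat a x k j t) at h
  set f : ℝ → ℝ := fun y => y ^ (2 * j) * Real.exp (-t * (a * y ^ (2 * k))) with hf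
  have hev : ∀ y, f (-y) = f y := fun y => by simp [hf, Even.neg_pow]
  have hpos : HasSum (fun n : ℕ => f (x + ((n : ℤ) : ℝ))) (powHeat a x k j t) := by
    refine h.congr_fun fun n => ?_
    simp only [hf, Int.cast_natCast, add_comm x]
  have hneg : HasSum (fun n : ℕ => f (x + ((-(n + 1 : ℤ) : ℤ) : ℝ)))
      (powHeat a x k j t + 2 * if j = 0 then x - 1 / 2 else 0) := by
    rcases hx with rfl | rfl
    · have h1 := (hasSum_nat_add_iff' 1).2 h
      have hval : powHeat a 0 k j t + 2 * (if j = 0 then (0 : ℝ) - 1 / 2 else 0) =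
          powHeat a 0 k j t - ∑ i ∈ Finset.range 1,
            ((i : ℝ) + 0) ^ (2 * j) * Real.exp (-t * (a * ((i : ℝ) + 0) ^ (2 * k))) := by
        by_cases hj : j = 0
        · subst hj; simp [hk.ne']; ring
        · simp [hj]
      rw [hval]
      refine h1.congr_fun fun n => ?_
      rw [zero_add, Int.cast_neg, hev]
      simp [hf]
    · rw [show (if j = 0 then (1 / 2 : ℝ) - 1 / 2 else 0) = 0 by simp, mul_zero, add_zero]
      refine h.congr_fun fun n => ?_
      rw [← hev]
      have : -(1 / 2 + ((-(n + 1 : ℤ) : ℤ) : ℝ)) = (n : ℝ) + 1 / 2 := by push_cast; ring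
      simp only [this, hf]
  have := HasSum.of_nat_of_neg_add_one (f := fun n : ℤ => f (x + n)) hpos hneg
  rwa [show powHeat a x k j t + (powHeat a x k j t + 2 * if j = 0 then x - 1 / 2 else 0) =
    2 * (powHeat a x k j t + if j = 0 then x - 1 / 2 else 0) by ring] at this

lemma exists_abs_jacobiRem_le (ha : 0 < a) (hx : x = 0 ∨ x = 1 / 2) (hk : 0 < k) (j R : ℕ) :
    ∃ C, ∀ t : ℝ, 0 < t →
      |jacobiRem a x k j t| ≤ C * (a * t) ^ (((R : ℝ) + 1 - 2 * j) / (2 * k)) := by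
  obtain ⟨C, hC⟩ := exists_norm_tsum_sub_integral_le (powExpSchwartz (2 * j) hk) R
  refine ⟨C / 2, fun t ht => ?_⟩
  have hat : 0 < a * t := mul_pos ha ht
  -- This mesh satisfies `τ ^ (2 * k) = a * t`, so sampling `y ^ (2 * j) * exp (-y ^ (2 * k))` at `τ
  -- * (x + n)` gives the heat series times `τ ^ (2 * j)`.
  set τ : ℝ := (a * t) ^ (1 / (2 * k : ℝ)) with hτ
  have hτ0 : 0 < τ := Real.rpow_pos_of_pos hat _
  have hpow : ∀ s : ℝ, (a * t) ^ (s / (2 * k)) = τ ^ s := fun s => by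
    rw [hτ, ← Real.rpow_mul hat.le]; congr 1; ring
  have hτk : τ ^ (2 * k) = a * t := by
    rw [hτ, ← Real.rpow_natCast, ← Real.rpow_mul hat.le]
    have : (1 / (2 * k : ℝ)) * ((2 * k : ℕ) : ℝ) = 1 := by push_cast; field_simp
    rw [this, Real.rpow_one]
  have h1 := (hasSum_int_powHeat ha hx hk j ht).mul_left (τ ^ (2 * j))
  have h2 : ∑' n : ℤ, powExpSchwartz (2 * j) hk (τ * (x + n)) =
      ((τ ^ (2 * j) * (2 * (powHeat a x k j t + if j = 0 then x - 1 / 2 else 0)) : ℝ) : ℂ) := by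
    rw [← h1.tsum_eq, Complex.ofReal_tsum]
    congr 1
    ext n
    rw [powExpSchwartz_apply]
    congr 1
    rw [mul_pow, mul_pow, hτk, ← mul_assoc]
    congr 2
    ring
  have h3 := hC τ hτ0 x
  rw [h2, integral_powExpSchwartz, ← Complex.ofReal_inv, ← Complex.ofReal_mul,
    ← Complex.ofReal_sub, Complex.norm_real, Real.norm_eq_abs] at h3
  have h4 : τ ^ (2 * j) * (2 * (powHeat a x k j t + if j = 0 then x - 1 / 2 else 0)) -
      τ⁻¹ * (2 * (1 / (2 * (k : ℝ)) * Real.Gamma ((1 + 2 * (j : ℝ)) / (2 * (k : ℝ))))) =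
      2 * τ ^ (2 * j) * jacobiRem a x k j t := by
    have h5 : (a * t) ^ (-((1 + 2 * (j : ℝ)) / (2 * (k : ℝ)))) = τ⁻¹ * (τ ^ (2 * j))⁻¹ := by
      rw [← neg_div, hpow, neg_add, Real.rpow_add hτ0, Real.rpow_neg_one, Real.rpow_neg hτ0.le,
        ← Real.rpow_natCast τ (2 * j)]
      push_cast
      rfl
    rw [jacobiRem, h5]
    field_simp
  rw [h4, abs_mul, abs_of_pos (by positivity : 0 < 2 * τ ^ (2 * j))] at h3
  have h6 : (a * t) ^ (((R : ℝ) + 1 - 2 * j) / (2 * k)) = τ ^ (R + 1) / τ ^ (2 * j) := by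
    rw [hpow, Real.rpow_sub hτ0, ← Real.rpow_natCast τ (2 * j), ← Real.rpow_natCast τ (R + 1)]
    push_cast
    rfl
  rw [h6, ← mul_div_assoc, le_div_iff₀ (by positivity)]
  linarith

lemma jacobiRem_isLittleO (ha : 0 < a) (hx : x = 0 ∨ x = 1 / 2) (hk : 0 < k) (j : ℕ) (R : ℝ) :
    jacobiRem a x k j =o[𝓝[>] 0] fun t : ℝ => t ^ R := by
  -- Chosen so that the exponent `(N + 1 - 2 j) / (2 k)` of the bound exceeds `R`.
  obtain ⟨N, hN⟩ := exists_nat_gt (2 * k * R + 2 * j)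
  obtain ⟨C, hC⟩ := exists_abs_jacobiRem_le ha hx hk j N
  set s : ℝ := ((N : ℝ) + 1 - 2 * j) / (2 * k) with hs
  have hRs : R < s := by
    rw [hs, lt_div_iff₀ (by positivity)]; linarith
  have h1 : jacobiRem a x k j =O[𝓝[>] 0] fun t : ℝ => t ^ s := by
    refine Asymptotics.IsBigO.of_bound (C * a ^ s) ?_
    filter_upwards [self_mem_nhdsWithin] with t ht
    have ht' : (0 : ℝ) < t := ht
    have := hC t ht'
    rw [Real.mul_rpow ha.le ht'.le] at this
    rw [Real.norm_eq_abs, Real.norm_of_nonneg (Real.rpow_nonneg ht'.le _)]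
    linarith
  refine h1.trans_isLittleO ?_
  refine Asymptotics.isLittleO_of_tendsto' ?_ ?_
  · filter_upwards [self_mem_nhdsWithin] with t ht h
    exact absurd h (Real.rpow_pos_of_pos ht _).ne'
  · have h2 : Tendsto (fun t : ℝ => t ^ (s - R)) (𝓝[>] 0) (𝓝 0) := by
      have := (Real.continuousAt_rpow_const 0 (s - R) (Or.inr (by linarith))).tendsto
      rw [Real.zero_rpow (by linarith)] at this
      exact this.mono_left nhdsWithin_le_nhds
    refine h2.congr' ?_
    filter_upwards [self_mem_nhdsWithin] with t ht
    rw [Real.rpow_sub ht]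

end JacobiRemainder

/-! ### Flatness and non-vanishing of the full remainder -/

section FlatPart

/-- Every iterated derivative agrees on `(0, ∞)` with a member of `W`, so decay of the members alone
controls all derivatives. -/
lemma isFlat_of_closed_under_deriv {W : Set (ℝ → ℝ)}
    (ho : ∀ f ∈ W, ∀ R : ℝ, f =o[𝓝[>] 0] fun t : ℝ => t ^ R)
    (hd : ∀ f ∈ W, ∃ g ∈ W, ∀ t : ℝ, 0 < t → HasDerivAt f (g t) t) {f : ℝ → ℝ} (hf : f ∈ W) :
    IsFlat f := by
  refine ⟨contDiffOn_infty.2 fun n => ?_, fun j R => ?_⟩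
  · induction n generalizing f with
    | zero =>
      obtain ⟨g, -, hg⟩ := hd f hf
      exact contDiffOn_zero.2 fun t ht => (hg t ht).continuousAt.continuousWithinAt
    | succ n ih =>
      obtain ⟨g, hgW, hg⟩ := hd f hf
      push_cast
      rw [contDiffOn_succ_iff_deriv_of_isOpen isOpen_Ioi]
      refine ⟨fun t ht => (hg t ht).differentiableAt.differentiableWithinAt, by simp,
        (ih hgW).congr fun t ht => (hg t ht).deriv⟩
  · have key : ∃ g ∈ W, EqOn (iteratedDeriv j f) g (Ioi 0) := by
      induction j with
      | zero => exact ⟨f, hf, fun t _ => by rw [iteratedDeriv_zero]⟩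
      | succ j ih =>
        obtain ⟨g, hgW, hg⟩ := ih
        obtain ⟨g', hgW', hg'⟩ := hd g hgW
        refine ⟨g', hgW', fun t ht => ?_⟩
        rw [iteratedDeriv_succ, (hg.eventuallyEq_of_mem (Ioi_mem_nhds ht)).deriv_eq]
        exact (hg' t ht).deriv
    obtain ⟨g, hgW, hg⟩ := key
    exact (ho g hgW R).congr' (hg.symm.eventuallyEq_of_mem self_mem_nhdsWithin) EventuallyEq.rfl

/-- The remainder in the generalized Jacobi identity. -/
def flatPart (a x β : ℝ) (k : ℕ) (b : ℕ → ℝ) (q : ℕ) (t : ℝ) : ℝ :=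
  Real.exp (-t * β) * ∑ j ∈ Finset.range (q + 1), b j * jacobiRem a x k j t

variable {a x β : ℝ} {k : ℕ} {b : ℕ → ℝ} {q : ℕ}

lemma isFlat_flatPart (ha : 0 < a) (hx : x = 0 ∨ x = 1 / 2) (hk : 0 < k) :
    IsFlat (flatPart a x β k b q) := by
  have hx0 : 0 ≤ x := by rcases hx with rfl | rfl <;> norm_num
  let e : ℕ → ℝ → ℝ := fun j t => Real.exp (-t * β) * jacobiRem a x k j t
  -- All indices `j` are needed, not only `j ≤ q`, since differentiation raises the index by `k`.
  let W := Submodule.span ℝ (Set.range e)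
  have he : ∀ j, e j ∈ W := fun j => Submodule.subset_span ⟨j, rfl⟩
  refine isFlat_of_closed_under_deriv (W := (W : Set (ℝ → ℝ))) ?_ ?_ ?_
  · intro f hf R
    induction hf using Submodule.span_induction with
    | mem f hf =>
      obtain ⟨j, rfl⟩ := hf
      have h1 : (fun t : ℝ => Real.exp (-t * β)) =O[𝓝[>] 0] fun _ => (1 : ℝ) := by
        have : ContinuousAt (fun t : ℝ => Real.exp (-t * β)) 0 := by fun_prop
        exact (this.tendsto.mono_left nhdsWithin_le_nhds).isBigO_one ℝ
      have h2 := h1.mul_isLittleO (jacobiRem_isLittleO ha hx hk j R)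
      simp only [one_mul] at h2
      exact h2
    | zero => exact Asymptotics.isLittleO_zero _ _
    | add f g _ _ hf hg => exact hf.add hg
    | smul c f _ hf => exact hf.const_mul_left c
  · intro f hf
    induction hf using Submodule.span_induction with
    | mem f hf =>
      obtain ⟨j, rfl⟩ := hf
      refine ⟨(-β) • e j + (-a) • e (j + k), W.add_mem (W.smul_mem _ (he _)) (W.smul_mem _ (he _)),
        fun t ht => ?_⟩
      have h1 : HasDerivAt (fun t : ℝ => Real.exp (-t * β)) (Real.exp (-t * β) * (-1 * β)) t :=
        ((hasDerivAt_id t).neg.mul_const β).exp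
      refine (h1.mul (hasDerivAt_jacobiRem ha hx0 hk j ht)).congr_deriv ?_
      simp only [e, Pi.add_apply, Pi.smul_apply, smul_eq_mul]
      ring
    | zero => exact ⟨0, W.zero_mem, fun t _ => hasDerivAt_const t 0⟩
    | add f g _ _ hf hg =>
      obtain ⟨f', hf', hf⟩ := hf
      obtain ⟨g', hg', hg⟩ := hg
      exact ⟨f' + g', W.add_mem hf' hg', fun t ht => (hf t ht).add (hg t ht)⟩
    | smul c f _ hf =>
      obtain ⟨f', hf', hf⟩ := hf
      exact ⟨c • f', W.smul_mem c hf', fun t ht => (hf t ht).const_smul c⟩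
  · have : flatPart a x β k b q = ∑ j ∈ Finset.range (q + 1), b j • e j := by
      ext t
      simp only [flatPart, Finset.mul_sum, Finset.sum_apply, Pi.smul_apply, smul_eq_mul, e]
      exact Finset.sum_congr rfl fun j _ => by ring
    rw [this]
    exact W.sum_mem fun j _ => W.smul_mem _ (he j)

/-- Only the term `n = 0` with `x = 0` fails to decay; it is the constant `κ`. The other bases are
at least `1/2`, whence one common rate. -/
lemma exists_powHeat_sub_const_isBigO (ha : 0 < a) (hx : x = 0 ∨ x = 1 / 2) (hk : 0 < k) (j : ℕ) :
    ∃ κ : ℝ, (fun t => powHeat a x k j t - κ) =O[atTop]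
      fun t => Real.exp (-(a * (1 / 2) ^ (2 * k)) * t) := by
  rcases hx with rfl | rfl
  · have hS := isHeatSeries_powHeat ha le_rfl hk j
    set w : ℕ → ℝ := fun n => ((n : ℝ) + 0) ^ (2 * j) with hw
    set l : ℕ → ℝ := fun n => a * ((n : ℝ) + 0) ^ (2 * k) with hl
    have hS' : IsHeatSeries (fun n => if n = 0 then 0 else w n) l := by
      refine ⟨hS.nonneg, fun ε hε => ?_⟩
      refine Summable.of_nonneg_of_le (fun n => by positivity) (fun n => ?_) (hS.summable ε hε)
      split_ifs
      · simp; positivity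
      · exact le_rfl
    refine ⟨w 0, (hS'.isBigO_exp (δ := a * (1 / 2) ^ (2 * k)) fun n => ?_).congr' ?_
      EventuallyEq.rfl⟩
    · rcases Nat.eq_zero_or_pos n with rfl | hn
      · left; simp
      · right
        have : (1 : ℝ) ≤ n := by exact_mod_cast hn
        simp only [hl]
        gcongr
        linarith
    · filter_upwards [eventually_gt_atTop 0] with t ht
      have h1 := hS.hasSum ht
      have h2 := hS'.hasSum ht
      have h3 : HasSum (fun n => if n = 0 then w 0 else 0) (w 0) := hasSum_ite_eq 0 (w 0)
      have h4 := h2.add h3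
      have h5 := h4.congr_fun (g := fun n => w n * Real.exp (-t * l n)) fun n => by
        rcases Nat.eq_zero_or_pos n with rfl | hn
        · simp [hl, hk.ne']
        · simp [hn.ne']
      rw [powHeat, h1.unique h5, add_sub_cancel_right]
  · refine ⟨0, ?_⟩
    simp only [sub_zero]
    refine (isHeatSeries_powHeat ha (by norm_num) hk j).isBigO_exp fun n => Or.inr ?_
    gcongr
    linarith [Nat.cast_nonneg (α := ℝ) n]

/-- If `Q = X ^ m * Q₁` with `Q₁(0) ≠ 0`, then `Q(u) / u ^ m` tends both to `Q₁(0)` and to `0`. -/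
lemma polynomial_eq_zero_of_isLittleO {Q : Polynomial ℝ} {u : ℝ → ℝ} {l : Filter ℝ} [l.NeBot]
    (hu : Tendsto u l (𝓝 0)) (hu0 : ∀ᶠ t in l, u t ≠ 0)
    (hQ : ∀ m : ℕ, (fun t => Q.eval (u t)) =o[l] fun t => u t ^ m) : Q = 0 := by
  by_contra h
  obtain ⟨Q₁, h1, h2⟩ := Polynomial.exists_eq_pow_rootMultiplicity_mul_and_not_dvd Q h 0
  set m := Q.rootMultiplicity 0
  have h3 : Q₁.eval 0 ≠ 0 := fun h0 => h2 (Polynomial.dvd_iff_isRoot.2 h0)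
  have h4 : Tendsto (fun t => Q₁.eval (u t)) l (𝓝 (Q₁.eval 0)) :=
    (Q₁.continuous.tendsto 0).comp hu
  have h5 := (hQ m).tendsto_div_nhds_zero
  refine h3 (tendsto_nhds_unique h4 (h5.congr' ?_))
  filter_upwards [hu0] with t ht
  rw [h1, Polynomial.eval_mul, Polynomial.eval_pow, Polynomial.eval_sub, Polynomial.eval_X,
    Polynomial.eval_C, sub_zero, mul_div_cancel_left₀ _ (pow_ne_zero m ht)]

lemma not_forall_sum_jacobiRem_eq_zero (ha : 0 < a) (hx : x = 0 ∨ x = 1 / 2) (hk : 0 < k)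
    (hb : b q ≠ 0) :
    ¬ ∀ t : ℝ, 0 < t → ∑ j ∈ Finset.range (q + 1), b j * jacobiRem a x k j t = 0 := by
  intro h0
  choose κ hκ using fun j => exists_powHeat_sub_const_isBigO (x := x) ha hx hk j
  set δ : ℝ := a * (1 / 2) ^ (2 * k) with hδ
  have hδ0 : 0 < δ := by positivity
  set D : ℕ → ℝ := fun j =>
    1 / (2 * (k : ℝ)) * Real.Gamma ((1 + 2 * (j : ℝ)) / (2 * (k : ℝ))) with hD
  set K : ℝ := ∑ j ∈ Finset.range (q + 1), b j * (κ j + if j = 0 then x - 1 / 2 else 0) with hK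
  set u : ℝ → ℝ := fun t => (a * t) ^ (-(1 / (2 * (k : ℝ)))) with hu
  -- If the remainder vanishes, its Gamma terms minus the constants, a polynomial in `u`, equal the
  -- exponentially small part of the heat series. The coefficient of degree `1 + 2 q` comes from `b
  -- q` alone.
  set Q : Polynomial ℝ := ∑ j ∈ Finset.range (q + 1),
    Polynomial.C (b j * D j) * Polynomial.X ^ (1 + 2 * j) - Polynomial.C K with hQ
  have hupow : ∀ t, 0 < t → ∀ m : ℕ, (u t) ^ m = a ^ (-(m / (2 * (k : ℝ)))) *
      t ^ (-(m / (2 * (k : ℝ)))) := fun t ht m => by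
    rw [hu, ← Real.mul_rpow ha.le ht.le, ← Real.rpow_natCast, ← Real.rpow_mul (by positivity)]
    congr 1
    ring
  have hQu : ∀ t, 0 < t → Q.eval (u t) =
      ∑ j ∈ Finset.range (q + 1), b j * (powHeat a x k j t - κ j) := fun t ht => by
    have h1 := h0 t ht
    have h2 : Q.eval (u t) = ∑ j ∈ Finset.range (q + 1), b j * D j * u t ^ (1 + 2 * j) - K := by
      simp [hQ, Polynomial.eval_finsetSum]
    have h3 : ∑ j ∈ Finset.range (q + 1), b j * jacobiRem a x k j t =
        ∑ j ∈ Finset.range (q + 1), b j * (powHeat a x k j t - κ j) + K -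
          ∑ j ∈ Finset.range (q + 1), b j * D j * u t ^ (1 + 2 * j) := by
      rw [hK, ← Finset.sum_add_distrib, ← Finset.sum_sub_distrib]
      refine Finset.sum_congr rfl fun j _ => ?_
      have : u t ^ (1 + 2 * j) = (a * t) ^ (-((1 + 2 * (j : ℝ)) / (2 * (k : ℝ)))) := by
        rw [hu, ← Real.rpow_natCast, ← Real.rpow_mul (by positivity)]
        congr 1
        push_cast
        ring
      rw [this, jacobiRem]
      simp only [hD]
      ring
    linarith
  have hQO : (fun t => Q.eval (u t)) =O[atTop] fun t => Real.exp (-δ * t) := by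
    refine (Asymptotics.IsBigO.fun_sum (s := Finset.range (q + 1))
      fun j _ => (hκ j).const_mul_left (b j)).congr' ?_ EventuallyEq.rfl
    filter_upwards [eventually_gt_atTop 0] with t ht
    rw [hQu t ht]
  have hQ0 : Q = 0 := by
    refine polynomial_eq_zero_of_isLittleO (u := u) (l := atTop) ?_ ?_ fun m => ?_
    · have h1 := tendsto_rpow_neg_atTop (y := 1 / (2 * (k : ℝ))) (by positivity)
      exact h1.comp (tendsto_id.const_mul_atTop ha)
    · filter_upwards [eventually_gt_atTop 0] with t ht
      exact (Real.rpow_pos_of_pos (mul_pos ha ht) _).ne'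
    · refine hQO.trans_isLittleO ?_
      have h1 := (isLittleO_exp_neg_mul_rpow_atTop hδ0 (-(m / (2 * (k : ℝ))))).const_mul_right
        (c := a ^ (-(m / (2 * (k : ℝ))))) (Real.rpow_pos_of_pos ha _).ne'
      refine h1.congr' EventuallyEq.rfl ?_
      filter_upwards [eventually_gt_atTop 0] with t ht
      rw [hupow t ht]
  have hc : Q.coeff (1 + 2 * q) = b q * D q := by
    simp only [hQ, Polynomial.coeff_sub, Polynomial.finsetSum_coeff, Polynomial.coeff_C_mul,
      Polynomial.coeff_X_pow, Polynomial.coeff_C]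
    rw [if_neg (by omega), sub_zero, Finset.sum_eq_single q]
    · simp
    · intro j _ hj
      rw [if_neg (by omega), mul_zero]
    · simp
  rw [hQ0, Polynomial.coeff_zero] at hc
  have hDq : 0 < D q := by
    have := Real.Gamma_pos_of_pos (s := (1 + 2 * (q : ℝ)) / (2 * (k : ℝ))) (by positivity)
    simp only [hD]
    positivity
  exact mul_ne_zero hb hDq.ne' hc.symm

lemma exists_flatPart_ne_zero (ha : 0 < a) (hx : x = 0 ∨ x = 1 / 2) (hk : 0 < k) (hb : b q ≠ 0)
    {T : ℝ} (hT : 0 < T) : ∃ t ∈ Ioo 0 T, flatPart a x β k b q t ≠ 0 := by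
  have hx0 : 0 ≤ x := by rcases hx with rfl | rfl <;> norm_num
  by_contra! h
  refine not_forall_sum_jacobiRem_eq_zero ha hx hk hb ?_
  -- The identity theorem carries vanishing from near `T / 2` to the whole half-line.
  have han : AnalyticOnNhd ℝ (fun t => ∑ j ∈ Finset.range (q + 1), b j * jacobiRem a x k j t)
      (Ioi 0) := fun t ht =>
    Finset.analyticAt_fun_sum _ fun j _ => analyticAt_const.mul (analyticAt_jacobiRem ha hx0 hk j ht)
  have hz := han.eqOn_zero_of_preconnected_of_eventuallyEq_zero isPreconnected_Ioi
    (z₀ := T / 2) (by simpa using hT) ?_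
  · exact fun t ht => hz ht
  · filter_upwards [Ioo_mem_nhds (half_pos hT) (half_lt_self hT)] with t ht
    have := h t ht
    rw [flatPart] at this
    exact (mul_eq_zero.1 this).resolve_left (Real.exp_pos _).ne'

end FlatPart

/-! ### The generalized Jacobi identity -/

section JacobiIdentity

variable {a α β : ℝ} {k : ℕ} {b : ℕ → ℝ} {q : ℕ}

lemma fract_half_nat {α : ℝ} (hα : ∃ p : ℕ, α = (p : ℝ) / 2) :
    0 ≤ α ∧ (Int.fract α = 0 ∨ Int.fract α = 1 / 2) := by
  obtain ⟨p, rfl⟩ := hα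
  refine ⟨by positivity, ?_⟩
  rcases Nat.even_or_odd' p with ⟨r, rfl | rfl⟩
  · left
    have : ((2 * r : ℕ) : ℝ) / 2 = ((r : ℕ) : ℝ) := by push_cast; ring
    rw [this, Int.fract_natCast]
  · right
    have : ((2 * r + 1 : ℕ) : ℝ) / 2 = ((r : ℕ) : ℝ) + 1 / 2 := by push_cast; ring
    rw [this, Int.fract_natCast_add, Int.fract_eq_self]
    norm_num

lemma natFloor_add_fract (hα : 0 ≤ α) : (⌊α⌋₊ : ℝ) + Int.fract α = α := by
  rw [natCast_floor_eq_intCast_floor hα, Int.floor_add_fract]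

/-- The generalized Jacobi identity. -/
lemma hasSum_poly_exp (ha : 0 < a) (hα : 0 ≤ α) (hk : 0 < k) {t : ℝ} (ht : 0 < t) :
    HasSum (fun n => polyB b q α n * Real.exp (-t * polyA a α β k n))
      (jacobiMain a α β k b q t + flatPart a (Int.fract α) β k b q t) := by
  have hx0 := Int.fract_nonneg α
  set x := Int.fract α with hx
  have h1 : ∀ j, HasSum (fun n : ℕ => ((n : ℝ) + α) ^ (2 * j) *
      Real.exp (-t * (a * ((n : ℝ) + α) ^ (2 * k)))) (powHeat a x k j t -
        ∑ n ∈ Finset.range ⌊α⌋₊, ((n : ℝ) + x) ^ (2 * j) *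
          Real.exp (-t * (a * ((n : ℝ) + x) ^ (2 * k)))) := fun j => by
    -- As `α = ⌊α⌋ + x`, the series over `n + α` is the one over `n + x` with its first `⌊α⌋` terms
    -- dropped.
    refine ((hasSum_nat_add_iff' ⌊α⌋₊).2
      ((isHeatSeries_powHeat ha hx0 hk j).hasSum ht)).congr_fun fun n => ?_
    have : ((n + ⌊α⌋₊ : ℕ) : ℝ) + x = n + α := by
      rw [Nat.cast_add, add_assoc, hx, natFloor_add_fract hα]
    rw [this]
  have h2 := (hasSum_sum (s := Finset.range (q + 1)) fun j _ => (h1 j).mul_left (b j)).mul_left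
    (Real.exp (-t * β))
  have h3 : jacobiMain a α β k b q t + flatPart a x β k b q t =
      Real.exp (-t * β) * ∑ j ∈ Finset.range (q + 1), b j * (powHeat a x k j t -
        ∑ n ∈ Finset.range ⌊α⌋₊, ((n : ℝ) + x) ^ (2 * j) *
          Real.exp (-t * (a * ((n : ℝ) + x) ^ (2 * k)))) := by
    have h4 : b 0 * (x - 1 / 2) =
        ∑ j ∈ Finset.range (q + 1), b j * (if j = 0 then x - 1 / 2 else 0) := by
      simp [Finset.sum_ite_eq']
    rw [jacobiMain, flatPart, ← hx, ← mul_add, h4, ← Finset.sum_sub_distrib,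
      ← Finset.sum_sub_distrib, ← Finset.sum_add_distrib]
    congr 1
    refine Finset.sum_congr rfl fun j _ => ?_
    rw [jacobiRem]
    ring
  rw [h3]
  refine h2.congr_fun fun n => ?_
  rw [polyB, polyA, Finset.sum_mul, Finset.mul_sum]
  refine Finset.sum_congr rfl fun j _ => ?_
  rw [mul_add, Real.exp_add]
  ring

lemma isHeatSeries_poly (ha : 0 < a) (hα : 0 ≤ α) (hk : 0 < k) {N : ℕ}
    (hN : ∀ n, N ≤ n → 0 < polyA a α β k n) :
    IsHeatSeries (fun n => polyB b q α (n + N)) (fun n => polyA a α β k (n + N)) := by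
  refine ⟨fun n => (hN _ (Nat.le_add_left _ _)).le, fun ε hε => ?_⟩
  refine (summable_nat_add_iff (f := fun n => |polyB b q α n| * Real.exp (-ε * polyA a α β k n))
    N).2 ?_
  have h1 : Summable fun n : ℕ => Real.exp (-ε * β) * ∑ j ∈ Finset.range (q + 1),
      |b j| * (((n : ℝ) + α) ^ (2 * j) * Real.exp (-(ε * a) * ((n : ℝ) + α) ^ (2 * k))) :=
    (summable_sum fun j _ =>
      (summable_pow_mul_exp_neg hα (2 * j) hk (mul_pos hε ha)).mul_left |b j|).mul_left _
  refine Summable.of_nonneg_of_le (fun n => by positivity) (fun n => ?_) h1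
  have h2 : Real.exp (-ε * polyA a α β k n) =
      Real.exp (-ε * β) * Real.exp (-(ε * a) * ((n : ℝ) + α) ^ (2 * k)) := by
    rw [polyA, ← Real.exp_add]; ring_nf
  have h3 : |polyB b q α n| ≤ ∑ j ∈ Finset.range (q + 1), |b j| * ((n : ℝ) + α) ^ (2 * j) := by
    refine (Finset.abs_sum_le_sum_abs _ _).trans (Finset.sum_le_sum fun j _ => ?_)
    rw [abs_mul, abs_of_nonneg (by positivity : 0 ≤ ((n : ℝ) + α) ^ (2 * j))]
  rw [h2]
  calc _ ≤ (∑ j ∈ Finset.range (q + 1), |b j| * ((n : ℝ) + α) ^ (2 * j)) *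
        (Real.exp (-ε * β) * Real.exp (-(ε * a) * ((n : ℝ) + α) ^ (2 * k))) := by gcongr
    _ = _ := by
      rw [Finset.sum_mul, Finset.mul_sum]
      exact Finset.sum_congr rfl fun j _ => by ring

end JacobiIdentity

/-! ### Everywhere convergent power series -/

section PowerSeries

/-- `Φ` is the sum of an everywhere convergent power series, which is a polynomial if `p` holds. -/
def HasEntireSeries (p : Prop) (Φ : ℝ → ℝ) : Prop :=
  ∃ c : ℕ → ℝ, (∀ u, HasSum (fun m => c m * u ^ m) (Φ u)) ∧ (p → {m | c m ≠ 0}.Finite)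

/-- The exponential series occupies the degrees `r + l * i`; `Function.extend` fills the others with
`0`. If `μ = 0`, only `i = 0` survives. -/
lemma hasEntireSeries_pow_mul_exp {p : Prop} (D : ℝ) (r : ℕ) {l : ℕ} (hl : 0 < l) {μ : ℝ}
    (hμ : p → μ = 0) : HasEntireSeries p fun u => D * u ^ r * Real.exp (-u ^ l * μ) := by
  have hinj : Function.Injective fun i : ℕ => r + l * i := fun i j h => by
    have : l * i = l * j := by simpa using h
    exact Nat.eq_of_mul_eq_mul_left hl this
  refine ⟨Function.extend (fun i : ℕ => r + l * i) (fun i => D * ((-μ) ^ i / i.factorial)) 0,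
    fun u => ?_, fun hp => ?_⟩
  · rw [← hinj.hasSum_iff]
    · have h : HasSum (fun i : ℕ => (-u ^ l * μ) ^ i / i.factorial) (Real.exp (-u ^ l * μ)) := by
        rw [Real.exp_eq_exp_ℝ]; exact NormedSpace.expSeries_div_hasSum_exp _
      refine (h.mul_left (D * u ^ r)).congr_fun fun i => ?_
      simp only [Function.comp, hinj.extend_apply]
      rw [pow_add, pow_mul, show -u ^ l * μ = u ^ l * -μ by ring, mul_pow]
      ring
    · intro m hm
      rw [Function.extend_apply' _ _ _ (by simpa using hm)]
      simp
  · refine (Set.finite_singleton r).subset fun m hm => ?_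
    by_contra hmr
    apply hm
    by_cases h : ∃ i, r + l * i = m
    · obtain ⟨i, rfl⟩ := h
      have hi : i ≠ 0 := by rintro rfl; simp at hmr
      rw [hinj.extend_apply (fun i => D * ((-μ) ^ i / i.factorial)), hμ hp]
      simp [hi]
    · rw [Function.extend_apply' _ _ _ h]
      rfl

lemma HasEntireSeries.add {p : Prop} {Φ Ψ : ℝ → ℝ} (h₁ : HasEntireSeries p Φ)
    (h₂ : HasEntireSeries p Ψ) : HasEntireSeries p fun u => Φ u + Ψ u := by
  obtain ⟨c, hc, hc'⟩ := h₁
  obtain ⟨d, hd, hd'⟩ := h₂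
  refine ⟨fun m => c m + d m, fun u => ?_, fun hp => ((hc' hp).union (hd' hp)).subset fun m hm => ?_⟩
  · refine ((hc u).add (hd u)).congr_fun fun m => ?_
    ring
  · by_contra h
    simp only [Set.mem_union, Set.mem_ofPred_eq, not_or, not_not] at h
    exact hm (by simp only [h.1, h.2, add_zero])

lemma HasEntireSeries.sum {p : Prop} {ι : Type*} {Φ : ι → ℝ → ℝ} (s : Finset ι)
    (h : ∀ i ∈ s, HasEntireSeries p (Φ i)) : HasEntireSeries p fun u => ∑ i ∈ s, Φ i u := by
  classical
  induction s using Finset.induction_on with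
  | empty => exact ⟨0, fun u => by simp, fun _ => by simp⟩
  | insert i s hi ih =>
    simp only [Finset.sum_insert hi]
    exact (h i (Finset.mem_insert_self i s)).add
      (ih fun j hj => h j (Finset.mem_insert_of_mem hj))

end PowerSeries

/-! ### The expansion in powers of `t` -/

section Expansion

variable {k q : ℕ}

lemma rpow_neg_polePt {t : ℝ} (ht : 0 < t) (m : ℕ) :
    t ^ (-polePt k q m) = t ^ (-polyL k q) * (t ^ (1 / (2 * (k : ℝ)))) ^ m := by
  rw [← Real.rpow_natCast, ← Real.rpow_mul ht.le, ← Real.rpow_add ht, polePt]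
  congr 1
  ring

variable {c : ℕ → ℝ}

/-- For `t < 1` the exponents increase with `m`, so every power in the tail is at most its first
one. -/
lemma sub_sum_isBigO {G : ℝ → ℝ} (hc : Summable fun m => |c m|) (hk : 0 < k)
    (hG : ∀ t : ℝ, 0 < t → HasSum (fun m => c m * t ^ (-polePt k q m)) (G t)) (K : ℕ) :
    (fun t : ℝ => G t - ∑ m ∈ Finset.range K, c m * t ^ (-polePt k q m)) =O[𝓝[>] 0]
      fun t : ℝ => t ^ (-polePt k q K) := by
  refine Asymptotics.IsBigO.of_bound (∑' m, |c (m + K)|) ?_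
  filter_upwards [Ioo_mem_nhdsGT one_pos] with t ht
  have h1 := (hasSum_nat_add_iff' K).2 (hG t ht.1)
  have h2 : Summable fun m => |c (m + K)| := (summable_nat_add_iff K).2 hc
  rw [← h1.tsum_eq, ← tsum_mul_right]
  refine tsum_of_norm_bounded (h2.mul_right _).hasSum fun m => ?_
  rw [norm_mul, Real.norm_eq_abs (c _), Real.norm_of_nonneg (Real.rpow_nonneg ht.1.le _),
    Real.norm_of_nonneg (Real.rpow_nonneg ht.1.le _)]
  refine mul_le_mul_of_nonneg_left ?_ (abs_nonneg _)
  refine Real.rpow_le_rpow_of_exponent_ge ht.1 ht.2.le ?_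
  simp only [polePt, neg_sub]
  gcongr
  omega

/-- The M-test on `(t/2, 2t)`: the factor `s ^ (-L)` is bounded by its value at the left end, the
powers of `s ^ (1/(2k))` by those at the right end. -/
lemma tendstoLocallyUniformlyOn_sum {G : ℝ → ℝ}
    (hc : ∀ u : ℝ, 0 < u → Summable fun m => |c m| * u ^ m)
    (hG : ∀ t : ℝ, 0 < t → HasSum (fun m => c m * t ^ (-polePt k q m)) (G t)) :
    TendstoLocallyUniformlyOn
      (fun (K : ℕ) (t : ℝ) => ∑ m ∈ Finset.range K, c m * t ^ (-polePt k q m)) G atTop (Ioi 0) := by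
  intro V hV t ht
  have ht' : (0 : ℝ) < t := ht
  refine ⟨Ioo (t / 2) (2 * t), mem_nhdsWithin_of_mem_nhds
    (Ioo_mem_nhds (by linarith) (by linarith)), ?_⟩
  have hs := (hc ((2 * t) ^ (1 / (2 * (k : ℝ)))) (by positivity)).mul_right
    ((t / 2) ^ (-polyL k q))
  have hu := tendstoUniformlyOn_tsum_nat hs (f := fun m s => c m * s ^ (-polePt k q m))
    (s := Ioo (t / 2) (2 * t)) fun m s hs => ?_
  · filter_upwards [hu V hV] with K hK s hs
    rw [← (hG s (by linarith [hs.1])).tsum_eq]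
    exact hK s hs
  · have hs0 : 0 < s := by linarith [hs.1]
    have hL : 0 ≤ polyL k q := by unfold polyL; positivity
    rw [norm_mul, Real.norm_eq_abs, Real.norm_of_nonneg (Real.rpow_nonneg hs0.le _),
      rpow_neg_polePt hs0, mul_assoc, mul_comm (s ^ (-polyL k q))]
    have h1 : s ^ (1 / (2 * (k : ℝ))) ≤ (2 * t) ^ (1 / (2 * (k : ℝ))) :=
      Real.rpow_le_rpow hs0.le hs.2.le (by positivity)
    have h2 : s ^ (-polyL k q) ≤ (t / 2) ^ (-polyL k q) :=
      Real.rpow_le_rpow_of_nonpos (by linarith) hs.1.le (by linarith)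
    gcongr

variable {a α β : ℝ} {b : ℕ → ℝ}

/-- The explicit part of the truncated heat trace is a convergent series of powers of `t`. -/
lemma exists_hasSum_jacobiMain (ha : 0 < a) (hα : ∃ p : ℕ, α = (p : ℝ) / 2) (hk : 0 < k) (N : ℕ) :
    ∃ c : ℕ → ℝ, (∀ u : ℝ, 0 < u → Summable fun m => |c m| * u ^ m) ∧
      (∀ t : ℝ, 0 < t → HasSum (fun m => c m * t ^ (-polePt k q m))
        (jacobiMain a α β k b q t -
          ∑ n ∈ Finset.range N, polyB b q α n * Real.exp (-t * polyA a α β k n))) ∧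
      (β = 0 → (N : ℝ) + α ≤ 1 → {m : ℕ | c m ≠ 0}.Finite) := by
  obtain ⟨hα0, hx⟩ := fract_half_nat hα
  set x := Int.fract α with hxdef
  have hfl : (⌊α⌋₊ : ℝ) + x = α := natFloor_add_fract hα0
  have hx0 : 0 ≤ x := Int.fract_nonneg α
  have h2k : 0 < 2 * k := by omega
  -- Under `p` every exponential occurring below has exponent zero, so each power series is a
  -- polynomial.
  set p : Prop := β = 0 ∧ (N : ℝ) + α ≤ 1 with hp
  set D : ℕ → ℝ := fun j => b j * (1 / (2 * (k : ℝ))) *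
    Real.Gamma ((1 + 2 * (j : ℝ)) / (2 * (k : ℝ))) * a ^ (-((1 + 2 * (j : ℝ)) / (2 * (k : ℝ))))
    with hD
  have e1 : HasEntireSeries p fun u => ∑ j ∈ Finset.range (q + 1),
      D j * u ^ (2 * (q - j)) * Real.exp (-u ^ (2 * k) * β) :=
    HasEntireSeries.sum _ fun j _ => hasEntireSeries_pow_mul_exp _ _ h2k fun h => h.1
  have e2 : HasEntireSeries p fun u =>
      -(b 0 * (x - 1 / 2)) * u ^ (1 + 2 * q) * Real.exp (-u ^ (2 * k) * β) :=
    hasEntireSeries_pow_mul_exp _ _ h2k fun h => h.1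
  have e3 : HasEntireSeries p fun u => ∑ j ∈ Finset.range (q + 1), ∑ n ∈ Finset.range ⌊α⌋₊,
      -(b j * ((n : ℝ) + x) ^ (2 * j)) * u ^ (1 + 2 * q) *
        Real.exp (-u ^ (2 * k) * (β + a * ((n : ℝ) + x) ^ (2 * k))) := by
    refine HasEntireSeries.sum _ fun j _ => HasEntireSeries.sum _ fun n hn =>
      hasEntireSeries_pow_mul_exp _ _ h2k fun h => ?_
    have h1 : (n : ℝ) + 1 ≤ ⌊α⌋₊ := by exact_mod_cast Finset.mem_range.1 hn
    -- Here `n + 1 + x ≤ ⌊α⌋ + x = α ≤ 1 - N ≤ 1`, while `n` and `x` are non-negative.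
    have h2 : (n : ℝ) + x = 0 := by
      have := h.2
      have := Nat.cast_nonneg (α := ℝ) N
      have := Nat.cast_nonneg (α := ℝ) n
      linarith
    rw [h.1, h2, zero_pow h2k.ne']
    ring
  have e4 : HasEntireSeries p fun u => ∑ n ∈ Finset.range N,
      -(polyB b q α n) * u ^ (1 + 2 * q) * Real.exp (-u ^ (2 * k) * polyA a α β k n) := by
    refine HasEntireSeries.sum _ fun n hn => hasEntireSeries_pow_mul_exp _ _ h2k fun h => ?_
    have h1 : (n : ℝ) + 1 ≤ N := by exact_mod_cast Finset.mem_range.1 hn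
    have h2 : (n : ℝ) + α = 0 := by
      have := h.2
      have := Nat.cast_nonneg (α := ℝ) n
      linarith
    rw [polyA, h.1, h2, zero_pow h2k.ne']
    ring
  obtain ⟨c, hc, hfin⟩ := ((e1.add e2).add e3).add e4
  refine ⟨c, fun u hu => ?_, fun t ht => ?_, fun h1 h2 => hfin ⟨h1, h2⟩⟩
  · refine (hc u).summable.abs.congr fun m => ?_
    rw [abs_mul, abs_of_pos (pow_pos hu m)]
  · set u := t ^ (1 / (2 * (k : ℝ))) with hu
    have hupow : ∀ n : ℕ, u ^ n = t ^ ((n : ℝ) / (2 * k)) := fun n => by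
      rw [hu, ← Real.rpow_natCast, ← Real.rpow_mul ht.le]
      congr 1
      ring
    have hu2k : u ^ (2 * k) = t := by
      rw [hupow]
      have : ((2 * k : ℕ) : ℝ) / (2 * k) = 1 := by push_cast; field_simp
      rw [this, Real.rpow_one]
    -- Terms without a power of `t` in front sit at degree `1 + 2 q`, because `L = (1 + 2 q) / (2
    -- k)`.
    have hu1 : t ^ (-polyL k q) * u ^ (1 + 2 * q) = 1 := by
      rw [hupow, ← Real.rpow_add ht, polyL]
      push_cast
      rw [neg_add_cancel, Real.rpow_zero]
    have hu2 : ∀ j ∈ Finset.range (q + 1), t ^ (-polyL k q) * u ^ (2 * (q - j)) =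
        t ^ (-((1 + 2 * (j : ℝ)) / (2 * (k : ℝ)))) := fun j hj => by
      have hj' : j ≤ q := Nat.lt_succ_iff.1 (Finset.mem_range.1 hj)
      rw [hupow, ← Real.rpow_add ht, polyL]
      push_cast [Nat.cast_sub hj']
      congr 1
      ring
    have h := (hc u).mul_left (t ^ (-polyL k q))
    simp only [hu2k] at h
    have hval : jacobiMain a α β k b q t -
          ∑ n ∈ Finset.range N, polyB b q α n * Real.exp (-t * polyA a α β k n) =
        t ^ (-polyL k q) * (((∑ j ∈ Finset.range (q + 1),
          D j * u ^ (2 * (q - j)) * Real.exp (-t * β)) +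
          -(b 0 * (x - 1 / 2)) * u ^ (1 + 2 * q) * Real.exp (-t * β)) +
          (∑ j ∈ Finset.range (q + 1), ∑ n ∈ Finset.range ⌊α⌋₊,
            -(b j * ((n : ℝ) + x) ^ (2 * j)) * u ^ (1 + 2 * q) *
              Real.exp (-t * (β + a * ((n : ℝ) + x) ^ (2 * k)))) +
          ∑ n ∈ Finset.range N,
            -(polyB b q α n) * u ^ (1 + 2 * q) * Real.exp (-t * polyA a α β k n)) := by
      have f1 : t ^ (-polyL k q) * (∑ j ∈ Finset.range (q + 1),
          D j * u ^ (2 * (q - j)) * Real.exp (-t * β)) = Real.exp (-t * β) *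
          ∑ j ∈ Finset.range (q + 1), b j * (1 / (2 * (k : ℝ))) *
            Real.Gamma ((1 + 2 * (j : ℝ)) / (2 * (k : ℝ))) *
              (a * t) ^ (-((1 + 2 * (j : ℝ)) / (2 * (k : ℝ)))) := by
        rw [Finset.mul_sum, Finset.mul_sum]
        refine Finset.sum_congr rfl fun j hj => ?_
        rw [Real.mul_rpow ha.le ht.le, ← hu2 j hj]
        simp only [hD]
        ring
      have f3 : t ^ (-polyL k q) * (∑ j ∈ Finset.range (q + 1), ∑ n ∈ Finset.range ⌊α⌋₊,
            -(b j * ((n : ℝ) + x) ^ (2 * j)) * u ^ (1 + 2 * q) *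
              Real.exp (-t * (β + a * ((n : ℝ) + x) ^ (2 * k)))) =
          -(Real.exp (-t * β) * ∑ j ∈ Finset.range (q + 1), b j * ∑ n ∈ Finset.range ⌊α⌋₊,
            ((n : ℝ) + x) ^ (2 * j) * Real.exp (-t * (a * ((n : ℝ) + x) ^ (2 * k)))) := by
        rw [Finset.mul_sum, Finset.mul_sum, ← Finset.sum_neg_distrib]
        refine Finset.sum_congr rfl fun j _ => ?_
        rw [Finset.mul_sum, Finset.mul_sum, Finset.mul_sum, ← Finset.sum_neg_distrib]
        refine Finset.sum_congr rfl fun n _ => ?_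
        rw [mul_add, Real.exp_add]
        linear_combination (-(b j * ((n : ℝ) + x) ^ (2 * j)) * (Real.exp (-t * β) *
          Real.exp (-t * (a * ((n : ℝ) + x) ^ (2 * k))))) * hu1
      have f4 : t ^ (-polyL k q) * (∑ n ∈ Finset.range N,
            -(polyB b q α n) * u ^ (1 + 2 * q) * Real.exp (-t * polyA a α β k n)) =
          -∑ n ∈ Finset.range N, polyB b q α n * Real.exp (-t * polyA a α β k n) := by
        rw [Finset.mul_sum, ← Finset.sum_neg_distrib]
        refine Finset.sum_congr rfl fun n _ => ?_
        linear_combination (-(polyB b q α n) * Real.exp (-t * polyA a α β k n)) * hu1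
      rw [mul_add, mul_add, mul_add, f1, f3, f4, jacobiMain, ← hxdef]
      linear_combination (b 0 * (x - 1 / 2) * Real.exp (-t * β)) * hu1
    rw [hval]
    refine h.congr_fun fun m => ?_
    rw [rpow_neg_polePt ht]
    ring

end Expansion

/-! ### The series of principal parts -/

section Poles

variable {k q : ℕ}

lemma polePt_injective (hk : 0 < k) : Function.Injective (polePt k q) := fun m n h => by
  simp only [polePt, sub_right_inj] at h
  have : (m : ℝ) = n := by field_simp at h; exact h
  exact_mod_cast this

/-- The points tend to `-∞` along the real axis, so all but finitely many are at distance at least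
`1` from `s`. -/
lemma exists_dist_polePt_ge (hk : 0 < k) (s : ℂ) :
    ∃ δ > 0, ∀ m, s ≠ (polePt k q m : ℂ) → δ ≤ ‖s - (polePt k q m : ℂ)‖ := by
  have hfin : ∀ M : ℕ, ∃ δ > 0, ∀ m < M, s ≠ (polePt k q m : ℂ) → δ ≤ ‖s - (polePt k q m : ℂ)‖ := by
    intro M
    induction M with
    | zero => exact ⟨1, one_pos, by simp⟩
    | succ M ih =>
      obtain ⟨δ, hδ, h⟩ := ih
      by_cases hs : s = (polePt k q M : ℂ)
      · refine ⟨δ, hδ, fun m hm hm' => ?_⟩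
        rcases Nat.lt_succ_iff_lt_or_eq.1 hm with hm | rfl
        · exact h m hm hm'
        · exact absurd hs hm'
      · refine ⟨min δ ‖s - (polePt k q M : ℂ)‖, lt_min hδ (norm_pos_iff.2 (sub_ne_zero.2 hs)),
          fun m hm hm' => ?_⟩
        rcases Nat.lt_succ_iff_lt_or_eq.1 hm with hm | rfl
        · exact (min_le_left _ _).trans (h m hm hm')
        · exact min_le_right _ _
  obtain ⟨M, hM⟩ := exists_nat_ge ((1 + polyL k q - s.re) * (2 * k))
  obtain ⟨δ, hδ, h⟩ := hfin M
  refine ⟨min δ 1, lt_min hδ one_pos, fun m hm => ?_⟩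
  rcases lt_or_ge m M with hmM | hmM
  · exact (min_le_left _ _).trans (h m hmM hm)
  · refine (min_le_right _ _).trans (le_trans ?_ (Complex.re_le_norm _))
    have h1 : (M : ℝ) ≤ m := by exact_mod_cast hmM
    have h2 : 1 + polyL k q - s.re ≤ (m : ℝ) / (2 * k) := by
      rw [le_div_iff₀ (by positivity)]; linarith
    rw [Complex.sub_re, Complex.ofReal_re, polePt]
    linarith

lemma eventually_ne_polePt (hk : 0 < k) (s : ℂ) :
    ∀ᶠ z in 𝓝 s, ∀ m, s ≠ (polePt k q m : ℂ) → z ≠ (polePt k q m : ℂ) := by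
  obtain ⟨δ, hδ, h⟩ := exists_dist_polePt_ge (q := q) hk s
  filter_upwards [Metric.ball_mem_nhds s hδ] with z hz m hm hzm
  have := h m hm
  rw [Metric.mem_ball, dist_comm, dist_eq_norm, hzm] at hz
  linarith

variable {c : ℕ → ℝ}

/-- The sum of the principal parts `c m / (z - s_m)`. -/
def principalSum (k q : ℕ) (c : ℕ → ℝ) (z : ℂ) : ℂ :=
  ∑' m, (c m : ℂ) / (z - (polePt k q m : ℂ))

lemma exists_principalSum_bound (hk : 0 < k) (s : ℂ) :
    ∃ δ > 0, ∀ z ∈ Metric.ball s δ, ∀ m, s ≠ (polePt k q m : ℂ) →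
      z - (polePt k q m : ℂ) ≠ 0 ∧ ∀ c : ℝ, ‖(c : ℂ) / (z - (polePt k q m : ℂ))‖ ≤ |c| * δ⁻¹ := by
  obtain ⟨δ, hδ, h⟩ := exists_dist_polePt_ge (q := q) hk s
  refine ⟨δ / 2, by positivity, fun z hz m hm => ?_⟩
  have h1 := h m hm
  have h2 : ‖s - (polePt k q m : ℂ)‖ ≤ ‖s - z‖ + ‖z - (polePt k q m : ℂ)‖ := by
    simpa using norm_add_le (s - z) (z - (polePt k q m : ℂ))
  rw [Metric.mem_ball, dist_comm, dist_eq_norm] at hz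
  have h3 : δ / 2 ≤ ‖z - (polePt k q m : ℂ)‖ := by linarith
  refine ⟨norm_pos_iff.1 (lt_of_lt_of_le (by positivity) h3), fun c => ?_⟩
  rw [norm_div, Complex.norm_real, Real.norm_eq_abs, div_eq_mul_inv]
  gcongr

/-- Allowing `c'` to drop coefficients treats regular points and the regular part at a pole
together. -/
lemma analyticAt_principalSum_erase (hk : 0 < k) (hc : Summable fun m => |c m|) (s : ℂ)
    (c' : ℕ → ℝ) (hc' : ∀ m, c' m = 0 ∨ (c' m = c m ∧ s ≠ (polePt k q m : ℂ))) :
    AnalyticAt ℂ (principalSum k q c') s := by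
  obtain ⟨δ, hδ, h⟩ := exists_principalSum_bound (q := q) hk s
  refine DifferentiableOn.analyticAt (s := Metric.ball s δ) ?_ (Metric.ball_mem_nhds s hδ)
  refine Complex.differentiableOn_tsum_of_summable_norm (hc.mul_right δ⁻¹) (fun m z hz => ?_)
    Metric.isOpen_ball fun m z hz => ?_
  · rcases hc' m with h0 | ⟨-, hm⟩
    · simp only [h0, Complex.ofReal_zero, zero_div]
      exact differentiableWithinAt_const _
    · have := (h z hz m hm).1
      exact ((differentiableAt_const (c' m : ℂ)).fun_div (differentiableAt_id.sub_const _)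
        this).differentiableWithinAt
  · rcases hc' m with h0 | ⟨he, hm⟩
    · simp only [h0, Complex.ofReal_zero, zero_div, norm_zero]
      positivity
    · rw [he]
      exact (h z hz m hm).2 _

lemma analyticAt_principalSum (hk : 0 < k) (hc : Summable fun m => |c m|) {s : ℂ}
    (hs : ∀ m, s ≠ (polePt k q m : ℂ)) : AnalyticAt ℂ (principalSum k q c) s :=
  analyticAt_principalSum_erase hk hc s c fun m => Or.inr ⟨rfl, hs m⟩

/-- The neighbourhood need not be punctured: at the pole itself the singular term is `0` on both
sides by the convention for division by zero. -/
lemma exists_principalSum_eq (hk : 0 < k) (hc : Summable fun m => |c m|) (m₀ : ℕ) :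
    ∃ A : ℂ → ℂ, AnalyticAt ℂ A (polePt k q m₀ : ℂ) ∧ ∀ᶠ z in 𝓝 (polePt k q m₀ : ℂ),
      principalSum k q c z = (c m₀ : ℂ) / (z - (polePt k q m₀ : ℂ)) + A z := by
  have hne : ∀ m, m ≠ m₀ → (polePt k q m₀ : ℂ) ≠ (polePt k q m : ℂ) := fun m hm h =>
    hm (polePt_injective hk (by exact_mod_cast h.symm))
  refine ⟨principalSum k q fun m => if m = m₀ then 0 else c m,
    analyticAt_principalSum_erase hk hc _ _ fun m => ?_, ?_⟩
  · by_cases hm : m = m₀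
    · left; simp [hm]
    · right; exact ⟨by simp [hm], hne m hm⟩
  · obtain ⟨δ, hδ, h⟩ := exists_principalSum_bound (q := q) hk (polePt k q m₀ : ℂ)
    filter_upwards [Metric.ball_mem_nhds _ hδ] with z hz
    have hsum : Summable fun m => (c m : ℂ) / (z - (polePt k q m : ℂ)) := by
      refine Summable.of_norm_bounded_eventually (hc.mul_right δ⁻¹) ?_
      rw [Filter.eventually_cofinite]
      refine (Set.finite_singleton m₀).subset fun m hm => ?_
      by_contra hmm
      exact hm ((h z hz m (hne m hmm)).2 _)
    rw [principalSum, hsum.tsum_eq_add_tsum_ite m₀, principalSum]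
    congr 2
    ext m
    split_ifs <;> simp

end Poles

/-! ### Continuation of the Mellin transform -/

section Mellin

open MeasureTheory

/-- `F` on `(0, 1]` and `f` on `(1, ∞)`. -/
def mellinRest (f F : ℝ → ℝ) (t : ℝ) : ℂ := if t ≤ 1 then (F t : ℂ) else (f t : ℂ)

variable {f F : ℝ → ℝ} {k q : ℕ} {c : ℕ → ℝ}

lemma locallyIntegrableOn_ofReal (hf : ContinuousOn f (Ioi 0)) :
    LocallyIntegrableOn (fun t => (f t : ℂ)) (Ioi 0) :=
  (Complex.continuous_ofReal.comp_continuousOn hf).locallyIntegrableOn measurableSet_Ioi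

lemma locallyIntegrableOn_mellinRest (hf : ContinuousOn f (Ioi 0)) (hF : ContinuousOn F (Ioi 0)) :
    LocallyIntegrableOn (mellinRest f F) (Ioi 0) := by
  have h : mellinRest f F = fun t => (Iic 1).indicator (fun t => (F t : ℂ)) t +
      (Ioi 1).indicator (fun t => (f t : ℂ)) t := by
    ext t
    rcases le_or_gt t 1 with ht | ht
    · simp [mellinRest, ht]
    · simp [mellinRest, ht]
  rw [h]
  intro t ht
  obtain ⟨U, hU, h1⟩ := locallyIntegrableOn_ofReal hF t ht
  obtain ⟨V, hV, h2⟩ := locallyIntegrableOn_ofReal hf t ht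
  refine ⟨U ∩ V, inter_mem hU hV, ?_⟩
  exact ((h1.mono_set inter_subset_left).indicator measurableSet_Iic).add
    ((h2.mono_set inter_subset_right).indicator measurableSet_Ioi)

lemma isBigO_ofReal_left {l : Filter ℝ} {g h : ℝ → ℝ} (hg : g =O[l] h) :
    (fun t => (g t : ℂ)) =O[l] h := by
  refine Asymptotics.IsBigO.of_norm_left ?_
  simpa only [Complex.norm_real] using hg.norm_left

lemma mellinRest_isBigO_atTop {δ : ℝ} (hf : f =O[atTop] fun t => Real.exp (-δ * t)) :
    mellinRest f F =O[atTop] fun t => Real.exp (-δ * t) := by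
  refine (isBigO_ofReal_left hf).congr' ?_ EventuallyEq.rfl
  filter_upwards [eventually_gt_atTop 1] with t ht
  rw [mellinRest, if_neg (not_le.2 ht)]

lemma mellinRest_isBigO_zero (hF : ∀ R : ℝ, F =o[𝓝[>] 0] fun t : ℝ => t ^ R) (R : ℝ) :
    mellinRest f F =O[𝓝[>] 0] fun t : ℝ => t ^ R := by
  refine (isBigO_ofReal_left (hF R).isBigO).congr' ?_ EventuallyEq.rfl
  filter_upwards [Ioo_mem_nhdsGT one_pos] with t ht
  rw [mellinRest, if_pos ht.2.le]

/-- On `(0, 1]` each power is dominated by the one with `m = 0`, because `s_m ≤ s_0 = L`; this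
justifies integrating termwise. -/
lemma hasSum_mellin_indicator (hk : 0 < k) (hc : Summable fun m => |c m|) {G : ℝ → ℝ}
    (hG : ∀ t : ℝ, 0 < t → HasSum (fun m => c m * t ^ (-polePt k q m)) (G t)) {s : ℂ}
    (hs : polyL k q < s.re) :
    HasSum (fun m => (c m : ℂ) / (s - (polePt k q m : ℂ)))
      (mellin ((Ioc 0 1).indicator fun t => (G t : ℂ)) s) := by
  have hle : ∀ m, polePt k q m ≤ polyL k q := fun m => by
    rw [polePt]; linarith [show 0 ≤ (m : ℝ) / (2 * k) by positivity]
  set φ : ℕ → ℝ → ℂ := fun m => (Ioc 0 1).indicator fun t => (t : ℂ) ^ (-(polePt k q m : ℂ))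
  have hφ : ∀ m, HasMellin (φ m) s (1 / (s - (polePt k q m : ℂ))) := fun m => by
    have := hasMellin_cpow_Ioc (-(polePt k q m : ℂ)) (s := s) (by
      rw [Complex.neg_re, Complex.ofReal_re]; linarith [hle m])
    rwa [← sub_eq_add_neg] at this
  set ψ : ℕ → ℝ → ℂ := fun m t => (t : ℂ) ^ (s - 1) • ((c m : ℂ) • φ m t) with hψ
  have hint : ∀ m, HasMellin (fun t => (c m : ℂ) • φ m t) s ((c m : ℂ) / (s - (polePt k q m : ℂ))) :=
    fun m => by
      have := hasMellin_const_smul (hφ m).1 (c m : ℂ)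
      rwa [(hφ m).2, smul_eq_mul, mul_one_div] at this
  have hval : ∀ m, ∫ t in Ioi (0 : ℝ), ψ m t = (c m : ℂ) / (s - (polePt k q m : ℂ)) :=
    fun m => (hint m).2
  have hnorm : ∀ m, ∀ t ∈ Ioi (0 : ℝ), ‖ψ m t‖ ≤ |c m| * ‖(t : ℂ) ^ (s - 1) • φ 0 t‖ :=
    fun m t ht => by
      have ht0 : (0 : ℝ) < t := ht
      simp only [hψ, norm_smul, Complex.norm_real, Real.norm_eq_abs]
      rw [mul_left_comm]
      refine mul_le_mul_of_nonneg_left (mul_le_mul_of_nonneg_left ?_ (norm_nonneg _)) (abs_nonneg _)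
      simp only [φ]
      by_cases h1 : t ∈ Ioc (0 : ℝ) 1
      · rw [indicator_of_mem h1, indicator_of_mem h1, Complex.norm_cpow_eq_rpow_re_of_pos ht0,
          Complex.norm_cpow_eq_rpow_re_of_pos ht0]
        refine Real.rpow_le_rpow_of_exponent_ge ht0 h1.2 ?_
        simp only [Complex.neg_re, Complex.ofReal_re]
        rw [show polePt k q 0 = polyL k q by simp [polePt]]
        linarith [hle m]
      · rw [indicator_of_notMem h1, indicator_of_notMem h1]
  have hsumm : Summable fun m => ∫ t in Ioi (0 : ℝ), ‖ψ m t‖ := by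
    refine Summable.of_nonneg_of_le (fun m => integral_nonneg fun t => norm_nonneg _)
      (fun m => ?_) (hc.mul_right (∫ t in Ioi (0 : ℝ), ‖(t : ℂ) ^ (s - 1) • φ 0 t‖))
    rw [← integral_const_mul]
    exact setIntegral_mono_on (hint m).1.norm ((hφ 0).1.norm.const_mul _) measurableSet_Ioi
      (hnorm m)
  have h := hasSum_integral_of_summable_integral_norm (fun m => (hint m).1) hsumm
  have h2 := h.congr_fun (g := fun m => (c m : ℂ) / (s - (polePt k q m : ℂ))) fun m => (hval m).symm
  have heq : mellin ((Ioc 0 1).indicator fun t => (G t : ℂ)) s =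
      ∫ t in Ioi (0 : ℝ), ∑' m, ψ m t := by
    refine setIntegral_congr_fun measurableSet_Ioi fun t ht => ?_
    have ht0 : (0 : ℝ) < t := ht
    simp only [hψ, tsum_const_smul'']
    congr 1
    by_cases h1 : t ∈ Ioc (0 : ℝ) 1
    · simp only [φ, indicator_of_mem h1]
      rw [← (hG t ht0).tsum_eq, Complex.ofReal_tsum]
      congr 1
      ext m
      rw [Complex.ofReal_mul, Complex.ofReal_cpow ht0.le, smul_eq_mul, Complex.ofReal_neg]
    · simp [φ, indicator_of_notMem h1]
  rw [heq]
  exact h2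

/-- Meromorphic continuation of a Mellin transform, from an almost exact expansion at `0`. -/
theorem exists_mellin_continuation (hk : 0 < k) (hc : Summable fun m => |c m|)
    (hf : ContinuousOn f (Ioi 0)) (hF : ContinuousOn F (Ioi 0))
    (hflat : ∀ R : ℝ, F =o[𝓝[>] 0] fun t : ℝ => t ^ R) {δ : ℝ} (hδ : 0 < δ)
    (hfδ : f =O[atTop] fun t => Real.exp (-δ * t))
    (hG : ∀ t : ℝ, 0 < t → HasSum (fun m => c m * t ^ (-polePt k q m)) (f t - F t)) :
    ∃ M : ℂ → ℂ, (∀ s : ℂ, polyL k q < s.re → M s = mellin (fun t => (f t : ℂ)) s) ∧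
      (∀ s : ℂ, (∀ m, s ≠ (polePt k q m : ℂ)) → AnalyticAt ℂ M s) ∧
      ∀ m, ∃ A : ℂ → ℂ, AnalyticAt ℂ A (polePt k q m : ℂ) ∧ ∀ᶠ z in 𝓝 (polePt k q m : ℂ),
        M z = (c m : ℂ) / (z - (polePt k q m : ℂ)) + A z := by
  -- Flatness at `0` and exponential decay at infinity make this integral converge for every `s`.
  have hent : Differentiable ℂ (mellin (mellinRest f F)) := fun s =>
    mellin_differentiableAt_of_isBigO_rpow_exp hδ (locallyIntegrableOn_mellinRest hf hF)
      (mellinRest_isBigO_atTop hfδ) (mellinRest_isBigO_zero hflat (-(s.re - 1))) (by linarith)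
  refine ⟨fun s => principalSum k q c s + mellin (mellinRest f F) s, fun s hs => ?_,
    fun s hs => (analyticAt_principalSum hk hc hs).add (hent.analyticAt s), fun m => ?_⟩
  · have hfO : f =O[𝓝[>] 0] fun t : ℝ => t ^ (-polyL k q) := by
      have h1 := sub_sum_isBigO hc hk hG 0
      simp only [Finset.range_zero, Finset.sum_empty, sub_zero, polePt, Nat.cast_zero,
        zero_div] at h1
      simpa using h1.add (hflat (-polyL k q)).isBigO
    have h1 : MellinConvergent (fun t => (f t : ℂ)) s :=
      mellinConvergent_of_isBigO_rpow_exp hδ (locallyIntegrableOn_ofReal hf)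
        (isBigO_ofReal_left hfδ) (isBigO_ofReal_left hfO) hs
    have h2 : MellinConvergent (mellinRest f F) s :=
      mellinConvergent_of_isBigO_rpow_exp hδ (locallyIntegrableOn_mellinRest hf hF)
        (mellinRest_isBigO_atTop hfδ) (mellinRest_isBigO_zero hflat (-(s.re - 1))) (by linarith)
    have h3 := (hasMellin_sub h1 h2).2
    have h4 : mellin (fun t => (f t : ℂ) - mellinRest f F t) s =
        mellin ((Ioc 0 1).indicator fun t => ((f t - F t : ℝ) : ℂ)) s := by
      rw [mellin, mellin]
      refine setIntegral_congr_fun measurableSet_Ioi fun t ht => ?_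
      have ht0 : (0 : ℝ) < t := ht
      rcases le_or_gt t 1 with h | h
      · simp [mellinRest, h, ht0]
      · simp [mellinRest, not_le.2 h]
    have h5 := (hasSum_mellin_indicator hk hc hG hs).tsum_eq
    change principalSum k q c s + _ = _
    rw [principalSum, h5, ← h4, h3]
    ring
  · obtain ⟨A, hA, h⟩ := exists_principalSum_eq (q := q) hk hc m
    refine ⟨fun z => A z + mellin (mellinRest f F) z, hA.add (hent.analyticAt _), ?_⟩
    filter_upwards [h] with z hz
    rw [hz, add_assoc]

end Mellin

/-! ### Order and residue at a simple pole -/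

section SimplePoles

lemma neg_one_le_meromorphicOrderAt {f A : ℂ → ℂ} {s c : ℂ} (hA : AnalyticAt ℂ A s)
    (h : ∀ᶠ z in 𝓝[≠] s, f z = c / (z - s) + A z) : -1 ≤ meromorphicOrderAt f s := by
  have hB : AnalyticAt ℂ (fun z => c + (z - s) * A z) s := by fun_prop
  have hE : AnalyticAt ℂ (fun z => z - s) s := by fun_prop
  have h1 : f =ᶠ[𝓝[≠] s] (fun z => z - s)⁻¹ * fun z => c + (z - s) * A z := by
    filter_upwards [h, self_mem_nhdsWithin] with z hz hne
    have : z - s ≠ 0 := sub_ne_zero.2 hne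
    rw [hz, Pi.mul_apply, Pi.inv_apply]
    field_simp
  rw [meromorphicOrderAt_congr h1, meromorphicOrderAt_mul hE.meromorphicAt.inv hB.meromorphicAt,
    meromorphicOrderAt_inv, meromorphicOrderAt_id_sub_const]
  have h2 := hB.meromorphicOrderAt_nonneg
  calc (-1 : WithTop ℤ) = -1 + 0 := by rw [add_zero]
    _ ≤ _ := by gcongr

lemma hasResidueAt_of_simple {f A : ℂ → ℂ} {s c : ℂ} (hA : AnalyticAt ℂ A s)
    (h : ∀ᶠ z in 𝓝[≠] s, f z = c / (z - s) + A z) : HasResidueAt f s c := by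
  obtain ⟨ε, hε, h1⟩ := Metric.eventually_nhds_iff_ball.1
    ((eventually_nhdsWithin_iff.1 h).and hA.eventually_analyticAt)
  filter_upwards [Ioo_mem_nhdsGT hε] with r hr
  have hsub : Metric.closedBall s r ⊆ Metric.ball s ε := Metric.closedBall_subset_ball hr.2
  have hAd : DifferentiableOn ℂ A (Metric.closedBall s r) := fun z hz =>
    (h1 z (hsub hz)).2.differentiableAt.differentiableWithinAt
  have hA0 : (∮ z in C(s, r), A z) = 0 :=
    (hAd.mono Metric.closure_ball_subset_closedBall).diffContOnCl.circleIntegral_eq_zero hr.1.le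
  have hcong : (∮ z in C(s, r), f z) = ∮ z in C(s, r), c * (z - s)⁻¹ + A z := by
    refine circleIntegral.integral_congr hr.1.le fun z hz => ?_
    have hne : z ≠ s := by
      rintro rfl
      rw [Metric.mem_sphere, dist_self] at hz
      exact hr.1.ne hz
    rw [(h1 z (hsub (Metric.sphere_subset_closedBall hz))).1 hne, div_eq_mul_inv]
  have hi1 : CircleIntegrable (fun z => c * (z - s)⁻¹) s r := by
    refine ContinuousOn.circleIntegrable hr.1.le fun z hz => ?_
    have hne : z - s ≠ 0 := by
      rw [← norm_pos_iff, ← dist_eq_norm, Metric.mem_sphere.1 hz]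
      exact hr.1
    exact (continuousAt_const.mul ((continuousAt_id.sub continuousAt_const).inv₀
      hne)).continuousWithinAt
  have hi2 : CircleIntegrable A s r :=
    (hAd.continuousOn.mono Metric.sphere_subset_closedBall).circleIntegrable hr.1.le
  rw [hcong, circleIntegral.integral_add hi1 hi2, hA0, add_zero,
    circleIntegral.integral_const_mul, circleIntegral.integral_sub_center_inv s hr.1.ne']
  have : (2 * (Real.pi : ℂ) * Complex.I) ≠ 0 := Complex.two_pi_I_ne_zero
  field_simp

end SimplePoles

/-! ### The truncated zeta function -/

section Zeta

variable {a α β : ℝ} {k : ℕ} {b : ℕ → ℝ} {q : ℕ}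

lemma polyA_strictMono (ha : 0 < a) (hα : 0 ≤ α) (hk : 0 < k) : StrictMono (polyA a α β k) := by
  intro m n hmn
  have : (m : ℝ) < n := by exact_mod_cast hmn
  simp only [polyA]
  gcongr

lemma summable_polyB_div_polyA (ha : 0 < a) (hα : 0 ≤ α) (hk : 0 < k) {σ : ℝ}
    (hσ : polyL k q < σ) : Summable fun n => |polyB b q α n| / polyA a α β k n ^ σ := by
  have hσ0 : 0 < σ := lt_of_le_of_lt (by unfold polyL; positivity) hσ
  -- The terms are `O(n ^ (2 q - 2 k σ))`, so this condition, equivalent to `σ > L`, gives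
  -- convergence.
  have h1 : 1 < 2 * k * σ - 2 * q := by
    rw [polyL, div_lt_iff₀ (by positivity)] at hσ
    linarith
  set C : ℝ := ∑ j ∈ Finset.range (q + 1), |b j| * (1 + α) ^ (2 * q) with hC
  have hC0 : 0 ≤ C := by positivity
  refine Summable.of_norm_bounded_eventually_nat
    (g := fun n : ℕ => C / (a / 2) ^ σ * (1 / (n : ℝ) ^ (2 * k * σ - 2 * q)))
    ((Real.summable_one_div_nat_rpow.2 h1).mul_left _) ?_
  obtain ⟨n₀, hn₀⟩ := exists_nat_ge (2 * |β| / a)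
  filter_upwards [eventually_ge_atTop (max 1 n₀)] with n hn
  have hn1 : (1 : ℝ) ≤ n := by exact_mod_cast (le_max_left _ _).trans hn
  have hn2 : (n₀ : ℝ) ≤ n := by exact_mod_cast (le_max_right _ _).trans hn
  have hn0 : (0 : ℝ) < n := by linarith
  have hA : a / 2 * (n : ℝ) ^ (2 * k) ≤ polyA a α β k n := by
    have h2 : (n : ℝ) ^ (2 * k) ≤ ((n : ℝ) + α) ^ (2 * k) := by gcongr; linarith
    have h3 : (n : ℝ) ≤ (n : ℝ) ^ (2 * k) := le_self_pow₀ hn1 (by omega)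
    have h4 : 2 * |β| ≤ a * n := by
      rw [div_le_iff₀ ha] at hn₀; nlinarith
    have h5 := neg_abs_le β
    rw [polyA]
    nlinarith
  have hB : |polyB b q α n| ≤ C * (n : ℝ) ^ (2 * q) := by
    rw [polyB, hC, Finset.sum_mul]
    refine (Finset.abs_sum_le_sum_abs _ _).trans (Finset.sum_le_sum fun j hj => ?_)
    have hj' : j ≤ q := Nat.lt_succ_iff.1 (Finset.mem_range.1 hj)
    rw [abs_mul, abs_of_nonneg (by positivity : 0 ≤ ((n : ℝ) + α) ^ (2 * j)), mul_assoc, ← mul_pow]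
    refine mul_le_mul_of_nonneg_left ?_ (abs_nonneg _)
    calc ((n : ℝ) + α) ^ (2 * j) ≤ ((n : ℝ) + α) ^ (2 * q) :=
          pow_le_pow_right₀ (by linarith) (by omega)
      _ ≤ _ := by gcongr; nlinarith
  have hA0 : 0 < a / 2 * (n : ℝ) ^ (2 * k) := by positivity
  rw [Real.norm_of_nonneg (div_nonneg (abs_nonneg _) (Real.rpow_nonneg (hA0.le.trans hA) _))]
  calc |polyB b q α n| / polyA a α β k n ^ σ
      ≤ C * (n : ℝ) ^ (2 * q) / (a / 2 * (n : ℝ) ^ (2 * k)) ^ σ := by gcongr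
    _ = _ := by
      rw [Real.mul_rpow (by positivity) (by positivity), ← Real.rpow_natCast (n : ℝ) (2 * k),
        ← Real.rpow_mul hn0.le, ← Real.rpow_natCast (n : ℝ) (2 * q), Real.rpow_sub hn0]
      push_cast
      field_simp

/-- The poles of `Γ` are thus among the candidate points, so away from these `Γ` can be cancelled
against its inverse. -/
lemma exists_polePt_eq_neg (hk : 0 < k) (i : ℕ) : ∃ m, polePt k q m = -(i : ℝ) := by
  refine ⟨1 + 2 * q + 2 * k * i, ?_⟩
  rw [polePt, polyL]
  push_cast
  field_simp
  ring

/-- Meromorphic continuation and poles of the truncated zeta function. -/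
theorem exists_zeta_continuation (ha : 0 < a) (hα : 0 ≤ α) (hk : 0 < k) {N : ℕ}
    (hN : ∀ n, N ≤ n → 0 < polyA a α β k n) {f F : ℝ → ℝ} {c : ℕ → ℝ}
    (hf : ∀ t : ℝ, 0 < t →
      HasSum (fun n => polyB b q α (n + N) * Real.exp (-t * polyA a α β k (n + N))) (f t))
    (hc : Summable fun m => |c m|) (hF : IsFlat F)
    (hG : ∀ t : ℝ, 0 < t → HasSum (fun m => c m * t ^ (-polePt k q m)) (f t - F t)) :
    ∃ Z : ℂ → ℂ, IsZetaContinuation (polyA a α β k) (polyB b q α) N (polyL k q) Z ∧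
      (∀ s : ℂ, (∀ m : ℕ, s ≠ (polePt k q m : ℂ)) →
        AnalyticAt ℂ (fun z => Complex.Gamma z * Z z) s) ∧
      (∀ m : ℕ, -1 ≤ meromorphicOrderAt (fun z => Complex.Gamma z * Z z) (polePt k q m : ℂ)) ∧
      (∀ m : ℕ, HasResidueAt (fun z => Complex.Gamma z * Z z) (polePt k q m : ℂ) (c m : ℂ)) := by
  have hS := isHeatSeries_poly (b := b) (q := q) ha hα hk hN
  have hfe : ∀ t : ℝ, 0 < t → f t = realExpSum (fun n => polyB b q α (n + N))
      (fun n => polyA a α β k (n + N)) t := fun t ht => (hf t ht).unique (hS.hasSum ht)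
  have hfc : ContinuousOn f (Ioi 0) := hS.continuousOn_real.congr fun t ht => hfe t ht
  have hfO : f =O[atTop] fun t => Real.exp (-polyA a α β k N * t) := by
    refine (hS.isBigO_exp (δ := polyA a α β k N) fun n => Or.inr
      ((polyA_strictMono ha hα hk).monotone (Nat.le_add_left _ _))).congr' ?_ EventuallyEq.rfl
    filter_upwards [eventually_gt_atTop 0] with t ht
    rw [hfe t ht]
  have hflat : ∀ R : ℝ, F =o[𝓝[>] 0] fun t : ℝ => t ^ R := fun R => by
    simpa only [iteratedDeriv_zero] using hF.2 0 R
  obtain ⟨M, hM1, hM2, hM3⟩ := exists_mellin_continuation hk hc hfc hF.1.continuousOn hflat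
    (hN N le_rfl) hfO hG
  set Z : ℂ → ℂ := fun s => M s * (Complex.Gamma s)⁻¹ with hZ
  have hΓ : ∀ z : ℂ, (∀ m, z ≠ (polePt k q m : ℂ)) → Complex.Gamma z * Z z = M z := fun z hz => by
    have : Complex.Gamma z ≠ 0 := Complex.Gamma_ne_zero fun i => by
      obtain ⟨m, hm⟩ := exists_polePt_eq_neg (q := q) hk i
      have := hz m
      rw [hm] at this
      exact_mod_cast this
    rw [hZ]
    field_simp
  have hnear : ∀ m, ∃ A : ℂ → ℂ, AnalyticAt ℂ A (polePt k q m : ℂ) ∧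
      (∀ᶠ z in 𝓝[≠] (polePt k q m : ℂ), M z = (c m : ℂ) / (z - (polePt k q m : ℂ)) + A z) ∧
      ∀ᶠ z in 𝓝[≠] (polePt k q m : ℂ),
        Complex.Gamma z * Z z = (c m : ℂ) / (z - (polePt k q m : ℂ)) + A z := fun m => by
    obtain ⟨A, hA, h⟩ := hM3 m
    refine ⟨A, hA, h.filter_mono nhdsWithin_le_nhds, ?_⟩
    filter_upwards [h.filter_mono nhdsWithin_le_nhds, self_mem_nhdsWithin,
      (eventually_ne_polePt (q := q) hk (polePt k q m : ℂ)).filter_mono nhdsWithin_le_nhds]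
      with z h1 h2 h3
    rw [← h1]
    refine hΓ z fun n hn => ?_
    by_cases hmn : (polePt k q m : ℂ) = (polePt k q n : ℂ)
    · exact h2 (hn.trans hmn.symm)
    · exact h3 n hmn hn
  have hMmer : Meromorphic M := fun s => by
    by_cases hs : ∀ m, s ≠ (polePt k q m : ℂ)
    · exact (hM2 s hs).meromorphicAt
    · push Not at hs
      obtain ⟨m, rfl⟩ := hs
      obtain ⟨A, hA, h, -⟩ := hnear m
      have h1 : MeromorphicAt (fun z : ℂ => (c m : ℂ) / (z - (polePt k q m : ℂ)) + A z)
          (polePt k q m : ℂ) := by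
        have hE : AnalyticAt ℂ (fun z : ℂ => z - (polePt k q m : ℂ)) (polePt k q m : ℂ) := by
          fun_prop
        exact ((MeromorphicAt.const _ _).fun_div hE.meromorphicAt).fun_add hA.meromorphicAt
      exact h1.congr (h.mono fun z hz => hz.symm)
  refine ⟨Z, ⟨fun s => ?_, fun s hs => ?_⟩, fun s hs => ?_, fun m => ?_, fun m => ?_⟩
  · exact (hMmer s).fun_mul (Complex.differentiable_one_div_Gamma.analyticAt s).meromorphicAt
  · have hs0 : 0 < s.re := lt_of_le_of_lt (by unfold polyL; positivity) hs
    -- Termwise, the Mellin transform of `exp (-t A(n))` is `Γ(s) A(n) ^ (-s)`, so dividing by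
    -- `Γ(s)` leaves the zeta series.
    have h1 := hasSum_mellin (a := fun n => (polyB b q α (n + N) : ℂ))
      (p := fun n => polyA a α β k (n + N)) (F := fun t => (f t : ℂ)) (s := s)
      (fun n => Or.inr (hN _ (Nat.le_add_left _ _))) hs0
      (fun t ht => by
        have h := Complex.hasSum_ofReal.2 (hf t ht)
        refine h.congr_fun fun n => ?_
        rw [show -polyA a α β k (n + N) * t = -t * polyA a α β k (n + N) by ring,
          Complex.ofReal_mul]) (by
        have h := summable_polyB_div_polyA (b := b) (β := β) ha hα hk hs
        simpa only [Complex.norm_real, Real.norm_eq_abs] using (summable_nat_add_iff N).2 h)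
    rw [← hM1 s hs] at h1
    have hG0 := Complex.Gamma_ne_zero_of_re_pos hs0
    refine (h1.mul_right (Complex.Gamma s)⁻¹).congr_fun fun n => ?_
    rw [Complex.cpow_neg]
    field_simp
  · refine (hM2 s hs).congr ?_
    filter_upwards [eventually_ne_polePt (q := q) hk s] with z hz
    exact (hΓ z fun m => hz m (hs m)).symm
  · obtain ⟨A, hA, -, h⟩ := hnear m
    exact neg_one_le_meromorphicOrderAt hA h
  · obtain ⟨A, hA, -, h⟩ := hnear m
    exact hasResidueAt_of_simple hA h

end Zeta

end HeatTrace

end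

theorem mainTheorem8 {H : Type*} [NormedAddCommGroup H] [InnerProductSpace ℂ H] [CompleteSpace H]
    (a α β : ℝ) (ha : 0 < a) (hα : ∃ p : ℕ, α = (p : ℝ) / 2)
    (k : ℕ) (hk : 0 < k) (q : ℕ) (b : ℕ → ℝ) (hb : b q ≠ 0)
    (P : H →ₗ.[ℂ] H)
    (hP : HeatTrace.HasSpectrum P (HeatTrace.polyA a α β k) (HeatTrace.polyB b q α)) :
    -- the heat trace is well defined and given by the eigenvalue series
    (∀ t : ℝ, 0 < t → (∃! T : H →L[ℂ] H, HeatTrace.IsExpNeg P t T) ∧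
      HeatTrace.IsTraceClass (HeatTrace.expNeg P t) ∧
      HasSum (fun n => HeatTrace.polyB b q α n * Real.exp (-t * HeatTrace.polyA a α β k n))
        (HeatTrace.heatTrace P t)) ∧
    ∃ F : ℝ → ℝ,
      -- generalized Jacobi identity with a flat remainder that vanishes identically on no `(0, T)`
      HeatTrace.IsFlat F ∧
      (∀ T : ℝ, 0 < T → ∃ t ∈ Set.Ioo 0 T, F t ≠ 0) ∧
      (∀ t : ℝ, 0 < t →
        HeatTrace.heatTrace P t = HeatTrace.jacobiMain a α β k b q t + F t) ∧
      -- the residue expansion of the (truncated) heat trace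
      ∀ N : ℕ, (∀ n, N ≤ n → 0 < HeatTrace.polyA a α β k n) →
        ∃ (Z : ℂ → ℂ) (c : ℕ → ℝ),
          HeatTrace.IsZetaContinuation (HeatTrace.polyA a α β k) (HeatTrace.polyB b q α) N
            (HeatTrace.polyL k q) Z ∧
          (∀ s : ℂ, (∀ m : ℕ, s ≠ (HeatTrace.polePt k q m : ℂ)) →
            AnalyticAt ℂ (fun z => Complex.Gamma z * Z z) s) ∧
          (∀ m : ℕ, -1 ≤ meromorphicOrderAt (fun z => Complex.Gamma z * Z z)
            (HeatTrace.polePt k q m : ℂ)) ∧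
          (∀ m : ℕ, HeatTrace.HasResidueAt (fun z => Complex.Gamma z * Z z)
            (HeatTrace.polePt k q m : ℂ) (c m : ℂ)) ∧
          HeatTrace.IsAsymptoticExpansion
            (HeatTrace.truncHeatTrace P (HeatTrace.polyA a α β k) (HeatTrace.polyB b q α) N)
            c (fun m => -HeatTrace.polePt k q m) ∧
          HeatTrace.IsAlmostExactOn
            (HeatTrace.truncHeatTrace P (HeatTrace.polyA a α β k) (HeatTrace.polyB b q α) N)
            c (fun m => -HeatTrace.polePt k q m) F (Set.Ioi 0) ∧
          (∀ T : ℝ, 0 < T → ¬ HeatTrace.IsExactOn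
            (HeatTrace.truncHeatTrace P (HeatTrace.polyA a α β k) (HeatTrace.polyB b q α) N)
            c (fun m => -HeatTrace.polePt k q m) (Set.Ioo 0 T)) ∧
          -- finitely many terms
          (β = 0 → (N : ℝ) + α ≤ 1 → {m : ℕ | c m ≠ 0}.Finite) := by
  obtain ⟨hα0, hx⟩ := HeatTrace.fract_half_nat hα
  have hsum : ∀ t : ℝ, 0 < t → HasSum
      (fun n => HeatTrace.polyB b q α n * Real.exp (-t * HeatTrace.polyA a α β k n))
      (HeatTrace.jacobiMain a α β k b q t + HeatTrace.flatPart a (Int.fract α) β k b q t) :=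
    fun t ht => HeatTrace.hasSum_poly_exp ha hα0 hk ht
  have htr := fun t (ht : 0 < t) =>
    hP.heatTrace_spec (HeatTrace.polyA_strictMono ha hα0 hk).injective (hsum t ht).summable
  have hJ : ∀ t : ℝ, 0 < t → HeatTrace.heatTrace P t =
      HeatTrace.jacobiMain a α β k b q t + HeatTrace.flatPart a (Int.fract α) β k b q t :=
    fun t ht => (htr t ht).2.2.unique (hsum t ht)
  have hF := HeatTrace.isFlat_flatPart (β := β) (b := b) (q := q) ha hx hk
  have hF0 := fun T (hT : 0 < T) =>
    HeatTrace.exists_flatPart_ne_zero (β := β) ha hx hk hb hT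
  refine ⟨htr, HeatTrace.flatPart a (Int.fract α) β k b q, hF, hF0, hJ, fun N hN => ?_⟩
  obtain ⟨c, hc, hcsum, hcfin⟩ :=
    HeatTrace.exists_hasSum_jacobiMain (β := β) (b := b) (q := q) ha hα hk N
  have hc1 : Summable fun m => |c m| := by simpa using hc 1 one_pos
  set f := HeatTrace.truncHeatTrace P (HeatTrace.polyA a α β k) (HeatTrace.polyB b q α) N with hf
  have hfs : ∀ t : ℝ, 0 < t → HasSum (fun n => HeatTrace.polyB b q α (n + N) *
      Real.exp (-t * HeatTrace.polyA a α β k (n + N))) (f t) := fun t ht =>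
    (hasSum_nat_add_iff' N).2 (htr t ht).2.2
  have hG : ∀ t : ℝ, 0 < t → HasSum (fun m => c m * t ^ (-HeatTrace.polePt k q m))
      (f t - HeatTrace.flatPart a (Int.fract α) β k b q t) := fun t ht => by
    have hft : f t - HeatTrace.flatPart a (Int.fract α) β k b q t =
        HeatTrace.jacobiMain a α β k b q t - ∑ n ∈ Finset.range N,
          HeatTrace.polyB b q α n * Real.exp (-t * HeatTrace.polyA a α β k n) := by
      rw [hf, HeatTrace.truncHeatTrace, hJ t ht]
      ring
    rw [hft]
    exact hcsum t ht
  have hexact : HeatTrace.IsAlmostExactOn f c (fun m => -HeatTrace.polePt k q m)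
      (HeatTrace.flatPart a (Int.fract α) β k b q) (Set.Ioi 0) :=
    HeatTrace.tendstoLocallyUniformlyOn_sum hc hG
  obtain ⟨Z, hZ, hZa, hZo, hZr⟩ :=
    HeatTrace.exists_zeta_continuation ha hα0 hk hN hfs hc1 hF hG
  refine ⟨Z, c, hZ, hZa, hZo, hZr, fun K => ?_, hexact, fun T hT hE => ?_, hcfin⟩
  · have h1 := HeatTrace.sub_sum_isBigO hc1 hk hG K
    have h2 := (hF.2 0 (-HeatTrace.polePt k q K)).isBigO
    rw [iteratedDeriv_zero] at h2
    refine (h1.add h2).congr_left fun t => ?_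
    ring
  -- At a point of `(0, T)` where the remainder is nonzero, the partial sums would have two
  -- different limits.
  · obtain ⟨t, ht, hne⟩ := hF0 T hT
    have h1 := hE.tendsto_at ht
    have h2 := hexact.tendsto_at (a := t) ht.1
    have h3 := tendsto_nhds_unique h1 h2
    simp only at h3
    exact hne (by linarith)
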